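/- Let $q \ge 2$ be an integer (not necessarily prime), let $C_q$ be the cyclic group of order $q$, and let $$\theta = \min_{\rho>0}\,(1+\rho+\cdots+\rho^{q-1})\,\rho^{-(q-1)/3}.$$ For $\mathbf{t} \in C_q^n$, a (tri-colored) sum-free set in $C_q^n$ with target $\mathbf{t}$ is a collection of triples $(\mathbf{a}_i,\mathbf{b}_i,\mathbf{c}_i)$ of elements of $C_q^n$ such that $\mathbf{a}_i+\mathbf{b}_j+\mathbf{c}_k=\mathbf{t}$ if and only if $i=j=k$; its size is the number of triples. There are constants $C$ and $N$, depending only on $q$, such that for every integer $n \ge N$ and every target $\mathbf{t} \in C_q^n$ (in particular for the usual target $\mathbf{t}=\mathbf{0}$) there is a sum-free set in $C_q^n$ with target $\mathbf{t}$ of size at least $$\theta^n \exp\!\left(-2\sqrt{2\,\log 2\,\cdot\,\log\theta\,\cdot\, n}\;-\;C\log n\right),$$ where $\log$ is the natural logarithm. -/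

import Mathlib

/-- A (tri-colored) sum-free set with target `t` in an abelian group `G`: a finite collection of
triples `(a_i, b_i, c_i)` in `G` such that `a_i + b_j + c_k = t` if and only if `i = j = k`.
(The triples of such a collection are automatically pairwise distinct, so that it is a finite set of
triples, and its size is the cardinality of this set.) For `t = 0` this is a tri-colored sum-free
set in the usual sense. -/
def IsSumFreeWithTarget {G : Type*} [AddCommGroup G] (t : G) (S : Finset (G × G × G)) : Prop :=
  ∀ x ∈ S, ∀ y ∈ S, ∀ z ∈ S, x.1 + y.2.1 + z.2.2 = t ↔ (x = y ∧ y = z)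

/-- The function `(1 + ρ + ⋯ + ρ^(q-1)) ρ^(-(q-1)/3)` of a real variable `ρ`. -/
noncomputable def thetaFun (q : ℕ) (ρ : ℝ) : ℝ :=
  (∑ i ∈ Finset.range q, ρ ^ i) * ρ ^ (-(((q : ℝ) - 1) / 3))

/-- `θ = min_{ρ > 0} (1 + ρ + ⋯ + ρ^(q-1)) ρ^(-(q-1)/3)`; it is written as an infimum, which is
attained for `q ≥ 2` by the lemma below. -/
noncomputable def theta (q : ℕ) : ℝ := sInf (thetaFun q '' Set.Ioi (0 : ℝ))

/-- The infimum that defines `theta q` is a minimum. -/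
theorem theta_isLeast (q : ℕ) (hq : 2 ≤ q) :
    IsLeast (thetaFun q '' Set.Ioi (0 : ℝ)) (theta q) := by
  have hq1 : (0 : ℝ) < (q : ℝ) - 1 := by
    have h : (2 : ℝ) ≤ (q : ℝ) := by exact_mod_cast hq
    linarith
  have hq0 : (0 : ℝ) < q := by linarith
  have h1q : (1 : ℝ) ≤ q := by linarith
  set s : ℝ := ((q : ℝ) - 1) / 3 with hs
  have hs0 : 0 < s := by positivity
  have hone : thetaFun q 1 = q := by simp [thetaFun]
  set a : ℝ := (q : ℝ) ^ (-(1 / s)) with ha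
  set b : ℝ := (q : ℝ) ^ (1 / (2 * s)) with hb
  have ha0 : 0 < a := Real.rpow_pos_of_pos hq0 _
  have ha1 : a ≤ 1 := Real.rpow_le_one_of_one_le_of_nonpos h1q (by
    have : 0 < 1 / s := by positivity
    linarith)
  have hb1 : 1 ≤ b := Real.one_le_rpow h1q (by positivity)
  have hcont : ContinuousOn (thetaFun q) (Set.Icc a b) := by
    unfold thetaFun
    apply ContinuousOn.mul (by fun_prop)
    apply ContinuousOn.rpow_const continuousOn_id
    intro x hx
    left
    exact (lt_of_lt_of_le ha0 hx.1).ne'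
  obtain ⟨r, hr, hmin⟩ := isCompact_Icc.exists_isMinOn (Set.nonempty_Icc.2 (ha1.trans hb1)) hcont
  have hr1 : thetaFun q r ≤ q := by
    rw [← hone]
    exact hmin (show (1 : ℝ) ∈ Set.Icc a b from ⟨ha1, hb1⟩)
  have hleast : IsLeast (thetaFun q '' Set.Ioi (0 : ℝ)) (thetaFun q r) := by
    refine ⟨⟨r, lt_of_lt_of_le ha0 hr.1, rfl⟩, ?_⟩
    rintro _ ⟨x, hx, rfl⟩
    have hx0 : (0 : ℝ) < x := hx
    have hxs : 0 < x ^ (-s) := Real.rpow_pos_of_pos hx0 _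
    by_cases hxa : x < a
    · refine hr1.trans ?_
      have h1 : (1 : ℝ) ≤ ∑ i ∈ Finset.range q, x ^ i := by
        have := Finset.single_le_sum (f := fun i => x ^ i) (s := Finset.range q)
          (fun i _ => by positivity) (Finset.mem_range.2 (show 0 < q by omega))
        simpa using this
      have h2 : (q : ℝ) ≤ x ^ (-s) := by
        have h3 : a ^ (-s) ≤ x ^ (-s) :=
          Real.rpow_le_rpow_of_nonpos hx0 hxa.le (by linarith)
        have h4 : a ^ (-s) = q := by
          rw [ha, ← Real.rpow_mul hq0.le]
          have : -(1 / s) * -s = 1 := by field_simp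
          rw [this, Real.rpow_one]
        linarith
      calc (q : ℝ) ≤ x ^ (-s) := h2
        _ ≤ (∑ i ∈ Finset.range q, x ^ i) * x ^ (-s) := le_mul_of_one_le_left hxs.le h1
    · by_cases hxb : b < x
      · refine hr1.trans ?_
        have h1 : x ^ (3 * s) ≤ ∑ i ∈ Finset.range q, x ^ i := by
          have := Finset.single_le_sum (f := fun i => x ^ i) (s := Finset.range q)
            (fun i _ => by positivity) (Finset.mem_range.2 (show q - 1 < q by omega))
          have h5 : (3 * s : ℝ) = ((q - 1 : ℕ) : ℝ) := by
            rw [hs, Nat.cast_sub (by omega)]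
            push_cast
            ring
          rw [h5, Real.rpow_natCast]
          exact this
        have h2 : (q : ℝ) ≤ x ^ (2 * s) := by
          have h3 : b ^ (2 * s) ≤ x ^ (2 * s) :=
            Real.rpow_le_rpow (by linarith) hxb.le (by positivity)
          have h4 : b ^ (2 * s) = q := by
            rw [hb, ← Real.rpow_mul hq0.le]
            have : 1 / (2 * s) * (2 * s) = 1 := by field_simp
            rw [this, Real.rpow_one]
          linarith
        calc (q : ℝ) ≤ x ^ (2 * s) := h2
          _ = x ^ (3 * s) * x ^ (-s) := by
            rw [← Real.rpow_add hx0]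
            congr 1
            ring
          _ ≤ (∑ i ∈ Finset.range q, x ^ i) * x ^ (-s) :=
            mul_le_mul_of_nonneg_right h1 hxs.le
      · exact hmin (show x ∈ Set.Icc a b from ⟨not_lt.1 hxa, not_lt.1 hxb⟩)
  have : theta q = thetaFun q r := hleast.csInf_eq
  rw [this]
  exact hleast

/-!
Write `θ = S ρ ^ (-(q - 1) / 3)` with `S = 1 + ρ + ⋯ + ρ ^ (q - 1)` at the minimizing `ρ`. The
condition for a minimum says that the distribution `ψ i = ρ ^ i / S` on the letters `0, …, q - 1`
has mean `(q - 1) / 3`; its entropy is `log θ`, and `ρ < 1`, so that `ψ` is decreasing.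

*Coupling.* `ψ` is the common marginal of a rotation-invariant distribution on the triples of
letters with sum `q - 1`. This holds for every nonincreasing `ψ` on `[0, s]` with mean `s / 3`
(`isTripleMarginal_of_antitone`). Take away from `ψ` as much mass as possible by a weight on the
triples that leaves a nonincreasing remainder. A nonzero remainder has descents `x ≤ 2s / 3` and
`y ≥ 2s / 3` (`exists_descents`), and for any such `x` and `y` there is a nonzero weight whose
marginal has descents only at `x` and `y`, a small multiple of which could still be taken away. Such
a weight is supplied by `exists_marginal_of_add_le`, `exists_marginal_of_le_add`,
`isTripleMarginal_intervalInd`, or, for `s / 2 < x < 2s / 3`, by the reflection `i ↦ x - i` and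
induction on `s`.

*Words.* Rounding `n` times the coupling down to integers gives a word `w` of length almost `n`
whose set `V` of rearrangements has `θ ^ n` elements up to a polynomial factor, and such that some
triple of elements of `V` adds up to `q - 1` at each place (`exists_word`). By symmetry, every
element of `V` is in the same number `D` of such triples at each of the three positions. By the
condition on the mean, three elements of `V` with sum `-1` modulo `q` have sum `q - 1`
(`mem_wordTriples_of_modEq`).

*Hashing.* Let `p` be a prime of size about `D`, and `R` a subset of `ℤ/p` without three-term
arithmetic progressions. Random affine hash functions for the three positions send every triple to
an arithmetic progression, hence the triples that are hashed into `R` to constant progressions. On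
average at least `|V| D |R| / (2 p²)` of them share no coordinate with another such triple
(`exists_isolated_subset`), and those form a sum-free set after a translation
(`exists_isSumFreeWithTarget`). As `p` is at most a constant times `D ≤ |V| ≤ θ ^ n`, Behrend's
bound for `|R|` with its sharp constant (`exists_rothNumberNat_ge`) gives the claim.
-/

/-! ### Measures on triples with prescribed marginals -/

/-- The triples of natural numbers with sum `s`. -/
def sumTriples (s : ℕ) : Finset (ℕ × ℕ × ℕ) :=
  (Finset.range (s + 1) ×ˢ Finset.range (s + 1) ×ˢ Finset.range (s + 1)).filter
    fun t => t.1 + t.2.1 + t.2.2 = s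

/-- The number of coordinates of the triple `t` that are equal to `i`. -/
def coordCount (t : ℕ × ℕ × ℕ) (i : ℕ) : ℝ :=
  (if t.1 = i then 1 else 0) + (if t.2.1 = i then 1 else 0) + (if t.2.2 = i then 1 else 0)

/-- `ψ` is the sum of the three coordinate marginals of a nonnegative weight on the triples of
natural numbers with sum `s`. -/
def IsTripleMarginal (s : ℕ) (ψ : ℕ → ℝ) : Prop :=
  ∃ w : ℕ × ℕ × ℕ → ℝ, (∀ t, 0 ≤ w t) ∧ ∀ i, ∑ t ∈ sumTriples s, w t * coordCount t i = ψ i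

theorem mem_sumTriples {s : ℕ} {t : ℕ × ℕ × ℕ} :
    t ∈ sumTriples s ↔ t.1 + t.2.1 + t.2.2 = s := by
  simp only [sumTriples, Finset.mem_filter, Finset.mem_product, Finset.mem_range]
  omega

theorem coordCount_nonneg (t : ℕ × ℕ × ℕ) (i : ℕ) : 0 ≤ coordCount t i := by
  unfold coordCount
  positivity

theorem coordCount_eq_zero_of_lt {s : ℕ} {t : ℕ × ℕ × ℕ} (ht : t ∈ sumTriples s) {i : ℕ}
    (hi : s < i) : coordCount t i = 0 := by
  rw [mem_sumTriples] at ht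
  simp only [coordCount]
  rw [if_neg (by omega), if_neg (by omega), if_neg (by omega)]
  simp

theorem one_le_coordCount_fst (t : ℕ × ℕ × ℕ) : 1 ≤ coordCount t t.1 := by
  unfold coordCount
  rw [if_pos rfl]
  have : (0 : ℝ) ≤ (if t.2.1 = t.1 then 1 else 0) := by positivity
  have : (0 : ℝ) ≤ (if t.2.2 = t.1 then 1 else 0) := by positivity
  linarith

theorem sum_coordCount_mul {s : ℕ} {t : ℕ × ℕ × ℕ} (ht : t ∈ sumTriples s) :
    ∑ i ∈ Finset.range (s + 1), (3 * (i : ℝ) - s) * coordCount t i = 0 := by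
  rw [mem_sumTriples] at ht
  have h1 : ∀ m : ℕ, m ≤ s →
      ∑ i ∈ Finset.range (s + 1), (3 * (i : ℝ) - s) * (if m = i then 1 else 0) = 3 * m - s := by
    intro m hm
    simp only [mul_ite, mul_one, mul_zero]
    rw [Finset.sum_ite_eq, if_pos (Finset.mem_range.2 (by omega))]
  simp only [coordCount, mul_add, Finset.sum_add_distrib]
  rw [h1 _ (by omega), h1 _ (by omega), h1 _ (by omega)]
  have : (s : ℝ) = t.1 + t.2.1 + t.2.2 := by exact_mod_cast ht.symm
  rw [this]
  ring

theorem IsTripleMarginal.sum {κ : Type*} {s : ℕ} (J : Finset κ) (c : κ → ℝ)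
    (g : κ → ℕ × ℕ × ℕ) (hc : ∀ j ∈ J, 0 ≤ c j) (hg : ∀ j ∈ J, c j ≠ 0 → g j ∈ sumTriples s) :
    IsTripleMarginal s fun i => ∑ j ∈ J, c j * coordCount (g j) i := by
  classical
  refine ⟨fun t => ∑ j ∈ J, if g j = t then c j else 0, fun t => ?_, fun i => ?_⟩
  · exact Finset.sum_nonneg fun j hj => by split_ifs <;> simp [hc j hj]
  · simp only [Finset.sum_mul]
    rw [Finset.sum_comm]
    refine Finset.sum_congr rfl fun j hj => ?_
    by_cases h : c j = 0
    · simp [h]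
    · simp only [ite_mul, zero_mul]
      rw [Finset.sum_ite_eq, if_pos (hg j hj h)]

theorem IsTripleMarginal.sum_mul_eq_zero {s : ℕ} {ψ : ℕ → ℝ} (h : IsTripleMarginal s ψ) :
    ∑ i ∈ Finset.range (s + 1), (3 * (i : ℝ) - s) * ψ i = 0 := by
  obtain ⟨w, -, hw⟩ := h
  simp only [← hw, Finset.mul_sum]
  rw [Finset.sum_comm]
  refine Finset.sum_eq_zero fun t ht => ?_
  have := sum_coordCount_mul ht
  calc _ = w t * ∑ i ∈ Finset.range (s + 1), (3 * (i : ℝ) - s) * coordCount t i := by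
        rw [Finset.mul_sum]
        exact Finset.sum_congr rfl fun i _ => by ring
    _ = 0 := by rw [this, mul_zero]

theorem IsTripleMarginal.eq_zero_of_lt {s : ℕ} {ψ : ℕ → ℝ} (h : IsTripleMarginal s ψ) {i : ℕ}
    (hi : s < i) : ψ i = 0 := by
  obtain ⟨w, -, hw⟩ := h
  rw [← hw]
  exact Finset.sum_eq_zero fun t ht => by rw [coordCount_eq_zero_of_lt ht hi, mul_zero]

/-- Reflection of every coordinate in the interval `[0, x]`. -/
theorem IsTripleMarginal.reflect {s s' x : ℕ} {ψ : ℕ → ℝ} (h : IsTripleMarginal s' ψ)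
    (hs : s + s' = 3 * x) (hψ : ∀ i, x < i → ψ i = 0) :
    IsTripleMarginal s fun i => if i ≤ x then ψ (x - i) else 0 := by
  obtain ⟨w, hw0, hw⟩ := h
  have key : ∀ t ∈ sumTriples s', w t ≠ 0 → t.1 ≤ x ∧ t.2.1 ≤ x ∧ t.2.2 ≤ x := by
    intro t ht hne
    have h0 : ∀ i, x < i → coordCount t i = 0 := by
      intro i hi
      have h1 := hw i
      rw [hψ i hi, Finset.sum_eq_zero_iff_of_nonneg
        (fun t _ => mul_nonneg (hw0 t) (coordCount_nonneg t i))] at h1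
      exact (mul_eq_zero.1 (h1 t ht)).resolve_left hne
    have hp : ∀ i, coordCount t i = 0 → t.1 ≠ i ∧ t.2.1 ≠ i ∧ t.2.2 ≠ i := by
      intro i hi
      unfold coordCount at hi
      refine ⟨fun h => ?_, fun h => ?_, fun h => ?_⟩ <;> rw [if_pos h] at hi <;>
        split_ifs at hi <;> norm_num at hi
    refine ⟨?_, ?_, ?_⟩ <;> by_contra! hlt
    · exact (hp _ (h0 _ hlt)).1 rfl
    · exact (hp _ (h0 _ hlt)).2.1 rfl
    · exact (hp _ (h0 _ hlt)).2.2 rfl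
  have := IsTripleMarginal.sum (s := s) (sumTriples s') w
    (fun t => (x - t.1, x - t.2.1, x - t.2.2)) (fun t _ => hw0 t) (by
      intro t ht hne
      have := key t ht hne
      rw [mem_sumTriples] at ht ⊢
      dsimp only
      omega)
  convert this using 2 with i
  split_ifs with hi
  · rw [← hw]
    refine Finset.sum_congr rfl fun t ht => ?_
    by_cases hne : w t = 0
    · simp [hne]
    · have := key t ht hne
      congr 1
      simp only [coordCount]
      congr 1
      · congr 1
        · exact if_congr (by omega) rfl rfl
        · exact if_congr (by omega) rfl rfl
      · exact if_congr (by omega) rfl rfl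
  · symm
    refine Finset.sum_eq_zero fun t ht => ?_
    simp only [coordCount]
    rw [if_neg (by omega), if_neg (by omega), if_neg (by omega)]
    simp

/-- The indicator function of the interval `[a, b]`. -/
def intervalInd (a b i : ℕ) : ℝ := if a ≤ i ∧ i ≤ b then 1 else 0

theorem intervalInd_le_succ {a b i : ℕ} (h : i ≠ b) :
    intervalInd a b i ≤ intervalInd a b (i + 1) := by
  unfold intervalInd
  split_ifs <;> first | omega | norm_num

theorem intervalInd_nonneg (a b i : ℕ) : 0 ≤ intervalInd a b i := by
  unfold intervalInd
  positivity

theorem sum_ite_sub_eq {y k : ℕ} (hk : k ≤ y) (i : ℕ) :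
    ∑ j ∈ Finset.range (k + 1), (if y - j = i then (1 : ℝ) else 0) = intervalInd (y - k) y i := by
  unfold intervalInd
  by_cases h : y - k ≤ i ∧ i ≤ y
  · rw [if_pos h, Finset.sum_eq_single (y - i)]
    · rw [if_pos (by omega)]
    · intro j hj hne
      rw [Finset.mem_range] at hj
      rw [if_neg (by omega)]
    · intro hj
      rw [Finset.mem_range] at hj
      omega
  · rw [if_neg h]
    refine Finset.sum_eq_zero fun j hj => ?_
    rw [Finset.mem_range] at hj
    rw [if_neg (by omega)]

theorem single_le_succ {x i : ℕ} (h : i ≠ x) :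
    (if x = i then (1 : ℝ) else 0) ≤ if x = i + 1 then 1 else 0 := by
  rw [if_neg (fun hh => h hh.symm)]
  positivity

/-- A nonzero marginal with descents only at `x` and `y`, from the uniform weight on the triples
`(x, y - j, y - (k - j))`. -/
theorem exists_marginal_of_add_le {s x y : ℕ} (hxy : x + y ≤ s) (hy : 2 * s ≤ 3 * y) :
    ∃ Q, IsTripleMarginal s Q ∧ (∃ i, Q i ≠ 0) ∧ ∀ i, i ≠ x → i ≠ y → Q i ≤ Q (i + 1) := by
  obtain ⟨k, hk⟩ : ∃ k, x + 2 * y = s + k := ⟨x + 2 * y - s, by omega⟩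
  have hky : k ≤ y := by omega
  refine ⟨_, IsTripleMarginal.sum (s := s) (Finset.range (k + 1)) (fun _ => 1)
    (fun j => (x, y - j, y - (k - j))) (fun _ _ => zero_le_one) ?_, ?_⟩
  · intro j hj _
    rw [Finset.mem_range] at hj
    rw [mem_sumTriples]
    dsimp only
    omega
  have hQ : ∀ i, ∑ j ∈ Finset.range (k + 1), (1 : ℝ) * coordCount (x, y - j, y - (k - j)) i =
      (k + 1) * (if x = i then 1 else 0) + intervalInd (y - k) y i + intervalInd (y - k) y i := by
    intro i
    simp only [one_mul, coordCount, Finset.sum_add_distrib]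
    rw [sum_ite_sub_eq hky]
    have h2 := Finset.sum_flip (n := k) (fun j => if y - j = i then (1 : ℝ) else 0)
    rw [h2, sum_ite_sub_eq hky]
    by_cases hxi : x = i <;> simp [hxi]
  simp only [hQ]
  refine ⟨⟨y, ?_⟩, fun i hix hiy => ?_⟩
  · have h1 : intervalInd (y - k) y y = 1 := by simp [intervalInd]
    rw [h1]
    positivity
  · have h1 := intervalInd_le_succ (a := y - k) hiy
    have h2 := mul_le_mul_of_nonneg_left (single_le_succ hix) (show (0 : ℝ) ≤ k + 1 by positivity)
    linarith

/-- The Vandermonde identity in the upper index. -/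
theorem sum_antidiagonal_choose_mul_choose (N a c : ℕ) :
    ∑ p ∈ Finset.HasAntidiagonal.antidiagonal N, p.1.choose a * p.2.choose c =
      (N + 1).choose (a + c + 1) := by
  induction N generalizing c with
  | zero =>
    rcases a with _ | a <;> rcases c with _ | c <;> simp [Nat.choose_eq_zero_of_lt]
  | succ N ih =>
    rw [Finset.Nat.antidiagonal_succ', Finset.sum_cons, Finset.sum_map]
    rcases c with _ | c
    · have h0 := ih 0
      simp only [Nat.choose_zero_right, mul_one, add_zero] at h0 ⊢
      simp only [Function.Embedding.prodMap, Function.Embedding.coeFn_mk, Prod.map_fst,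
        Function.Embedding.refl_apply]
      rw [h0, Nat.choose_succ_succ (N + 1) a]
    · simp only [Function.Embedding.prodMap, Function.Embedding.coeFn_mk, Prod.map_fst,
        Prod.map_snd, Function.Embedding.refl_apply, Nat.succ_eq_add_one, Nat.choose_zero_succ,
        mul_zero, zero_add, Nat.choose_succ_succ _ c, mul_add, Finset.sum_add_distrib]
      rw [ih c, ih (c + 1), ← add_assoc, Nat.choose_succ_succ (N + 1) (a + c + 1)]

/-- Up to normalization, the probability that `a` of `l` black balls and `b` of `m` white balls lie
to the left of a marker, when the balls and the marker are arranged in random order. -/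
def markerWeight (l m a b : ℕ) : ℕ := (a + b).choose a * (l + m - (a + b)).choose (l - a)

theorem markerWeight_comm {l m a b : ℕ} (ha : a ≤ l) (hb : b ≤ m) :
    markerWeight l m a b = markerWeight m l b a := by
  unfold markerWeight
  rw [Nat.choose_symm_of_eq_add (show a + b = a + b from rfl),
    Nat.choose_symm_of_eq_add (show l + m - (a + b) = (l - a) + (m - b) by omega),
    add_comm a b, add_comm l m]

theorem sum_markerWeight {l m a : ℕ} (ha : a ≤ l) :
    ∑ b ∈ Finset.range (m + 1), markerWeight l m a b = (l + m + 1).choose (l + 1) := by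
  have h := sum_antidiagonal_choose_mul_choose (l + m) a (l - a)
  rw [Finset.Nat.sum_antidiagonal_eq_sum_range_succ_mk, show a + (l - a) + 1 = l + 1 by omega] at h
  rw [← h]
  have h2 := Finset.sum_Ico_eq_sum_range
    (fun k => k.choose a * (l + m - k).choose (l - a)) a (a + m + 1)
  rw [show a + m + 1 - a = m + 1 by omega] at h2
  unfold markerWeight
  rw [← h2]
  refine Finset.sum_subset (fun k hk => ?_) fun k hk hk' => ?_
  · rw [Finset.mem_Ico] at hk
    rw [Finset.mem_range]
    omega
  · rw [Finset.mem_range] at hk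
    rw [Finset.mem_Ico] at hk'
    by_cases hka : k < a
    · rw [Nat.choose_eq_zero_of_lt hka, zero_mul]
    · rw [Nat.choose_eq_zero_of_lt (show l + m - k < l - a by omega), mul_zero]

theorem sum_markerWeight' {l m b : ℕ} (hb : b ≤ m) :
    ∑ a ∈ Finset.range (l + 1), markerWeight l m a b = (l + m + 1).choose (m + 1) := by
  rw [add_comm l m, ← sum_markerWeight hb]
  refine Finset.sum_congr rfl fun a ha => markerWeight_comm ?_ hb
  rw [Finset.mem_range] at ha
  omega

theorem sum_markerWeight_add_eq {l m k : ℕ} (hk : k ≤ l + m) :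
    ∑ a ∈ Finset.range (l + 1), ∑ b ∈ Finset.range (m + 1),
      (if a + b = k then markerWeight l m a b else 0) = (l + m).choose l := by
  have h := Nat.add_choose_eq k (l + m - k) l
  rw [Finset.Nat.sum_antidiagonal_eq_sum_range_succ_mk, show k + (l + m - k) = l + m by omega] at h
  rw [h]
  refine Finset.sum_congr rfl fun a ha => ?_
  rw [Finset.mem_range] at ha
  by_cases hak : a ≤ k ∧ k ≤ a + m
  · rw [Finset.sum_eq_single (k - a)]
    · rw [if_pos (by omega)]
      unfold markerWeight
      rw [show a + (k - a) = k by omega]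
    · intro b _ hne
      rw [if_neg (by omega)]
    · intro hb
      rw [Finset.mem_range] at hb
      omega
  · rw [Finset.sum_eq_zero]
    · symm
      by_cases hka : k < a
      · rw [Nat.choose_eq_zero_of_lt hka, zero_mul]
      · rw [Nat.choose_eq_zero_of_lt (show l + m - k < l - a by omega), mul_zero]
    · intro b hb
      rw [Finset.mem_range] at hb
      rw [if_neg (by omega)]

/-- A nonzero marginal with descents only at `x` and `y`: a positive combination of the uniform
measures on three intervals ending at `x`, `x` and `y`, the third of which is as long as the first
two together. -/
theorem exists_marginal_of_le_add {s x y : ℕ} (hxy : s ≤ x + y) (hx : 2 * x ≤ s) (hy : y ≤ s) :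
    ∃ Q, IsTripleMarginal s Q ∧ (∃ i, Q i ≠ 0) ∧ ∀ i, i ≠ x → i ≠ y → Q i ≤ Q (i + 1) := by
  obtain ⟨m, hm⟩ : ∃ m, x + y = s + m := ⟨x + y - s, by omega⟩
  have hmx : m ≤ x := by omega
  refine ⟨_, IsTripleMarginal.sum (s := s) (Finset.range (x + 1) ×ˢ Finset.range (m + 1))
    (fun p => (markerWeight x m p.1 p.2 : ℝ))
    (fun p => (x - p.1, x - p.2, y - (x + m - (p.1 + p.2)))) (fun _ _ => Nat.cast_nonneg _) ?_, ?_⟩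
  · rintro ⟨a, b⟩ hab _
    rw [Finset.mem_product, Finset.mem_range, Finset.mem_range] at hab
    rw [mem_sumTriples]
    dsimp only at hab ⊢
    omega
  have hQ : ∀ i, ∑ p ∈ Finset.range (x + 1) ×ˢ Finset.range (m + 1),
      (markerWeight x m p.1 p.2 : ℝ) *
        coordCount (x - p.1, x - p.2, y - (x + m - (p.1 + p.2))) i =
      ((x + m + 1).choose (x + 1) : ℝ) * intervalInd (x - x) x i +
      ((x + m + 1).choose (m + 1) : ℝ) * intervalInd (x - m) x i +
      ((x + m).choose x : ℝ) * intervalInd (y - (x + m)) y i := by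
    intro i
    simp only [coordCount, mul_add, Finset.sum_add_distrib]
    congr 1
    · congr 1
      · rw [Finset.sum_product, ← sum_ite_sub_eq le_rfl, Finset.mul_sum]
        refine Finset.sum_congr rfl fun a ha => ?_
        rw [Finset.mem_range] at ha
        rw [← sum_markerWeight (show a ≤ x by omega)]
        by_cases h : x - a = i <;> simp [h]
      · rw [Finset.sum_product_right, ← sum_ite_sub_eq hmx, Finset.mul_sum]
        refine Finset.sum_congr rfl fun b hb => ?_
        rw [Finset.mem_range] at hb
        rw [← sum_markerWeight' (show b ≤ m by omega)]
        by_cases h : x - b = i <;> simp [h]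
    · unfold intervalInd
      rw [Finset.sum_product]
      by_cases hi : y - (x + m) ≤ i ∧ i ≤ y
      · rw [if_pos hi, mul_one,
          ← sum_markerWeight_add_eq (show x + m - (y - i) ≤ x + m by omega)]
        push_cast
        refine Finset.sum_congr rfl fun a ha => Finset.sum_congr rfl fun b hb => ?_
        rw [Finset.mem_range] at ha hb
        rw [mul_ite, mul_one, mul_zero]
        exact if_congr (by omega) rfl rfl
      · rw [if_neg hi, mul_zero]
        refine Finset.sum_eq_zero fun a ha => Finset.sum_eq_zero fun b hb => ?_
        rw [Finset.mem_range] at ha hb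
        dsimp only
        rw [if_neg (by omega), mul_zero]
  simp only [hQ]
  refine ⟨⟨x, ?_⟩, fun i hix hiy => ?_⟩
  · have h1 : intervalInd (x - x) x x = 1 := by simp [intervalInd]
    have h2 := intervalInd_nonneg (x - m) x x
    have h3 := intervalInd_nonneg (y - (x + m)) y x
    have h4 : 0 < ((x + m + 1).choose (x + 1) : ℝ) := by
      exact_mod_cast Nat.choose_pos (by omega)
    rw [h1]
    positivity
  · gcongr <;> exact intervalInd_le_succ (by assumption)

/-- The uniform measure on `[0, 2h]` is a marginal, by a cyclic shift of the interval. -/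
theorem isTripleMarginal_intervalInd (h : ℕ) :
    IsTripleMarginal (3 * h) fun i => 3 * intervalInd 0 (2 * h) i := by
  have key := IsTripleMarginal.sum (s := 3 * h) (Finset.range (2 * h + 1)) (fun _ => 1)
    (fun i => if i ≤ h then (i, i + h, 2 * h - 2 * i) else (i, i - (h + 1), 4 * h + 1 - 2 * i))
    (fun _ _ => zero_le_one) (by
      intro i hi _
      rw [Finset.mem_range] at hi
      rw [mem_sumTriples]
      split_ifs <;> dsimp only <;> omega)
  -- each coordinate is a permutation of `[0, 2h]`, with the inverse `g`
  have perm : ∀ (f g : ℕ → ℕ), (∀ j ≤ 2 * h, f j ≤ 2 * h ∧ g (f j) = j) →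
      (∀ i ≤ 2 * h, g i ≤ 2 * h ∧ f (g i) = i) → ∀ i,
      ∑ j ∈ Finset.range (2 * h + 1), (if f j = i then (1 : ℝ) else 0) =
        intervalInd 0 (2 * h) i := by
    intro f g hf hg i
    unfold intervalInd
    by_cases hi : i ≤ 2 * h
    · rw [if_pos ⟨Nat.zero_le _, hi⟩, Finset.sum_eq_single (g i)]
      · rw [if_pos (hg i hi).2]
      · intro j hj hne
        rw [Finset.mem_range] at hj
        refine if_neg fun hh => hne ?_
        rw [← hh, (hf j (by omega)).2]
      · intro hh
        have := (hg i hi).1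
        rw [Finset.mem_range] at hh
        omega
    · rw [if_neg (by omega)]
      refine Finset.sum_eq_zero fun j hj => if_neg fun hh => ?_
      rw [Finset.mem_range] at hj
      have := (hf j (by omega)).1
      omega
  convert key using 2 with i
  simp only [one_mul, coordCount, Finset.sum_add_distrib]
  rw [perm (fun j => (if j ≤ h then (j, j + h, 2 * h - 2 * j)
      else (j, j - (h + 1), 4 * h + 1 - 2 * j)).1) id,
    perm (fun j => (if j ≤ h then (j, j + h, 2 * h - 2 * j)
      else (j, j - (h + 1), 4 * h + 1 - 2 * j)).2.1)
      (fun i => if h ≤ i then i - h else i + (h + 1)),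
    perm (fun j => (if j ≤ h then (j, j + h, 2 * h - 2 * j)
      else (j, j - (h + 1), 4 * h + 1 - 2 * j)).2.2)
      (fun i => if i % 2 = 0 then h - i / 2 else 2 * h - i / 2)]
  · ring
  all_goals intro j hj; (try simp only [id]); split_ifs <;> (try dsimp only at *) <;> omega


/-- A nonincreasing function on `[0, s]` with mean `s / 3` has a descent at or below `2s / 3` and
one at or above: it is a positive combination of indicators of intervals `[0, m]`, over its
descents `m`, and such an interval has mean `m / 2`. -/
theorem exists_descents {s : ℕ} {R : ℕ → ℝ} (hR : Antitone R) (hs : ∀ i, s < i → R i = 0)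
    (hmean : ∑ i ∈ Finset.range (s + 1), (3 * (i : ℝ) - s) * R i = 0) (hne : ∃ i, R i ≠ 0) :
    ∃ x y, 3 * x ≤ 2 * s ∧ 2 * s ≤ 3 * y ∧ y ≤ s ∧ R x ≠ R (x + 1) ∧ R y ≠ R (y + 1) := by
  have abel : ∀ n, ∑ i ∈ Finset.range (n + 1), (3 * (i : ℝ) - s) * R i =
      (∑ m ∈ Finset.range (n + 1), ((m + 1) * (3 * m - 2 * s) / 2 : ℝ) * (R m - R (m + 1))) +
        ((n + 1) * (3 * n - 2 * s) / 2 : ℝ) * R (n + 1) := by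
    intro n
    induction n with
    | zero =>
      simp
      ring
    | succ n ih =>
      rw [Finset.sum_range_succ, ih, Finset.sum_range_succ _ (n + 1)]
      push_cast
      ring
  have h0 := abel s
  rw [hmean, hs (s + 1) (by omega), mul_zero, add_zero] at h0
  have hd : ∀ m, 0 ≤ R m - R (m + 1) := fun m => sub_nonneg.2 (hR (Nat.le_succ m))
  -- if all the descents lie strictly on one side of `2s / 3`, then there are none
  have conc : (∀ m ≤ s, R m = R (m + 1)) → False := by
    intro h
    obtain ⟨i, hi⟩ := hne
    have hz : ∀ j, R (s + 1 - j) = 0 := by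
      intro j
      induction j with
      | zero => exact hs _ (by omega)
      | succ j ih =>
        by_cases hj : j ≤ s
        · rw [h _ (by omega), show s + 1 - (j + 1) + 1 = s + 1 - j by omega, ih]
        · rw [show s + 1 - (j + 1) = s + 1 - j by omega, ih]
    by_cases his : i ≤ s
    · exact hi (by rw [← hz (s + 1 - i)]; congr 1; omega)
    · exact hi (hs i (by omega))
  have hx : ∃ x, 3 * x ≤ 2 * s ∧ R x ≠ R (x + 1) := by
    by_contra! hcon
    refine conc fun m hm => ?_
    by_cases h3 : 3 * m ≤ 2 * s
    · exact hcon m h3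
    have hnn : ∀ m ∈ Finset.range (s + 1),
        0 ≤ ((m + 1) * (3 * m - 2 * s) / 2 : ℝ) * (R m - R (m + 1)) := by
      intro m _
      by_cases h3 : 3 * m ≤ 2 * s
      · rw [hcon m h3]; simp
      · have : (2 * s : ℝ) ≤ 3 * m := by exact_mod_cast (not_le.1 h3).le
        exact mul_nonneg (div_nonneg (mul_nonneg (by positivity) (by linarith)) two_pos.le) (hd m)
    have := (Finset.sum_eq_zero_iff_of_nonneg hnn).1 h0.symm m (Finset.mem_range.2 (by omega))
    have h4 : (2 * s : ℝ) < 3 * m := by exact_mod_cast (not_le.1 h3)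
    have h5 : (0 : ℝ) < (m + 1) * (3 * m - 2 * s) / 2 :=
      div_pos (mul_pos (by positivity) (by linarith)) two_pos
    linarith [(mul_eq_zero.1 this).resolve_left h5.ne']
  have hy : ∃ y, 2 * s ≤ 3 * y ∧ y ≤ s ∧ R y ≠ R (y + 1) := by
    by_contra! hcon
    refine conc fun m hm => ?_
    by_cases h3 : 2 * s ≤ 3 * m
    · exact hcon m h3 hm
    have hnn : ∀ m ∈ Finset.range (s + 1),
        ((m + 1) * (3 * m - 2 * s) / 2 : ℝ) * (R m - R (m + 1)) ≤ 0 := by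
      intro m hm
      rw [Finset.mem_range] at hm
      by_cases h3 : 2 * s ≤ 3 * m
      · rw [hcon m h3 (by omega)]; simp
      · have h4 : (3 * m : ℝ) ≤ 2 * s := by exact_mod_cast (not_le.1 h3).le
        refine mul_nonpos_of_nonpos_of_nonneg ?_ (hd m)
        have : (m + 1 : ℝ) * (3 * m - 2 * s) ≤ 0 :=
          mul_nonpos_of_nonneg_of_nonpos (by positivity) (by linarith)
        linarith
    have := (Finset.sum_eq_zero_iff_of_nonpos hnn).1 h0.symm m (Finset.mem_range.2 (by omega))
    have h4 : (3 * m : ℝ) < 2 * s := by exact_mod_cast (not_le.1 h3)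
    have h5 : (m + 1 : ℝ) * (3 * m - 2 * s) / 2 < 0 := by
      have : (m + 1 : ℝ) * (3 * m - 2 * s) < 0 :=
        mul_neg_of_pos_of_neg (by positivity) (by linarith)
      linarith
    linarith [(mul_eq_zero.1 this).resolve_left h5.ne]
  obtain ⟨x, hx1, hx2⟩ := hx
  obtain ⟨y, hy1, hy2, hy3⟩ := hy
  exact ⟨x, y, hx1, hy1, hy2, hx2, hy3⟩

theorem nonneg_of_antitone {s : ℕ} {R : ℕ → ℝ} (hR : Antitone R) (hs : ∀ i, s < i → R i = 0)
    (i : ℕ) : 0 ≤ R i := by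
  rw [← hs (i + s + 1) (by omega)]
  exact hR (by omega)

/-- The greedy step suffices: if every nonzero nonincreasing `R` on `[0, s]` with mean `s / 3`
admits a nonzero marginal all of whose descents are descents of `R`, then every such function is a
marginal. A weight of maximal total mass that leaves a nonincreasing remainder leaves nothing. -/
theorem isTripleMarginal_of_step {s : ℕ}
    (step : ∀ R : ℕ → ℝ, Antitone R → (∀ i, s < i → R i = 0) →
      ∑ i ∈ Finset.range (s + 1), (3 * (i : ℝ) - s) * R i = 0 → (∃ i, R i ≠ 0) →
      ∃ Q, IsTripleMarginal s Q ∧ (∃ i, Q i ≠ 0) ∧ ∀ i, R i = R (i + 1) → Q i ≤ Q (i + 1))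
    {ψ : ℕ → ℝ} (hψ : Antitone ψ) (hs : ∀ i, s < i → ψ i = 0)
    (hmean : ∑ i ∈ Finset.range (s + 1), (3 * (i : ℝ) - s) * ψ i = 0) :
    IsTripleMarginal s ψ := by
  set M : (ℕ × ℕ × ℕ → ℝ) → ℕ → ℝ := fun w i => ∑ t ∈ sumTriples s, w t * coordCount t i with hM
  have hMc : ∀ i, Continuous fun w => M w i := fun i => by
    simp only [hM]
    fun_prop
  have hMt : ∀ w, (∀ t, 0 ≤ w t) → IsTripleMarginal s (M w) := fun w hw => ⟨w, hw, fun _ => rfl⟩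
  set K : Set (ℕ × ℕ × ℕ → ℝ) := (Set.univ.pi fun _ => Set.Icc 0 (ψ 0)) ∩
    {w | ∀ i, M w i - M w (i + 1) ≤ ψ i - ψ (i + 1)} with hK
  have hKc : IsCompact K := by
    refine (isCompact_univ_pi fun _ => isCompact_Icc).inter_right ?_
    rw [Set.ofPred_forall]
    exact isClosed_iInter fun i => isClosed_le ((hMc i).sub (hMc (i + 1))) continuous_const
  have hψ0 := nonneg_of_antitone hψ hs
  have hKne : K.Nonempty := by
    refine ⟨fun _ => 0, fun _ _ => ⟨le_rfl, hψ0 0⟩, fun i => ?_⟩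
    simp only [hM, zero_mul, Finset.sum_const_zero, sub_zero]
    exact sub_nonneg.2 (hψ (Nat.le_succ i))
  obtain ⟨w, hwK, hmax⟩ := hKc.exists_isMaxOn hKne
    (f := fun w => ∑ t ∈ sumTriples s, w t) (by fun_prop)
  have hw0 : ∀ t, 0 ≤ w t := fun t => (hwK.1 t trivial).1
  set R : ℕ → ℝ := fun i => ψ i - M w i with hRdef
  have hRa : Antitone R := antitone_nat_of_succ_le fun i => by
    have := hwK.2 i
    simp only [hRdef]
    linarith
  have hRs : ∀ i, s < i → R i = 0 := fun i hi => by
    simp only [hRdef]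
    rw [hs i hi, (hMt w hw0).eq_zero_of_lt hi, sub_zero]
  have hRm : ∑ i ∈ Finset.range (s + 1), (3 * (i : ℝ) - s) * R i = 0 := by
    simp only [hRdef, mul_sub, Finset.sum_sub_distrib]
    have := (hMt w hw0).sum_mul_eq_zero
    simp only [sub_mul, Finset.sum_sub_distrib] at hmean this ⊢
    linarith
  by_cases hne : ∃ i, R i ≠ 0
  swap
  · push Not at hne
    convert hMt w hw0 using 1
    funext i
    exact sub_eq_zero.1 (hne i)
  exfalso
  obtain ⟨Q, ⟨w', hw'0, hw'⟩, ⟨i₀, hi₀⟩, hQ⟩ := step R hRa hRs hRm hne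
  have hQs : ∀ i, s < i → Q i = 0 := fun i hi => IsTripleMarginal.eq_zero_of_lt ⟨w', hw'0, hw'⟩ hi
  obtain ⟨ε, hε, hε0⟩ : ∃ ε : ℝ, (∀ i ∈ Finset.range (s + 1),
      ε * (Q i - Q (i + 1)) ≤ R i - R (i + 1)) ∧ 0 < ε := by
    have hev : ∀ᶠ ε : ℝ in nhdsWithin 0 (Set.Ioi 0), ∀ i ∈ Finset.range (s + 1),
        ε * (Q i - Q (i + 1)) ≤ R i - R (i + 1) := by
      rw [Filter.eventually_all_finset]
      intro i _
      rcases eq_or_ne (R i) (R (i + 1)) with h | h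
      · filter_upwards [self_mem_nhdsWithin] with ε hε
        rw [h, sub_self]
        exact mul_nonpos_of_nonneg_of_nonpos (le_of_lt hε) (sub_nonpos.2 (hQ i h))
      · have hpos : 0 < R i - R (i + 1) :=
          sub_pos.2 (lt_of_le_of_ne (hRa (Nat.le_succ i)) (Ne.symm h))
        have ht : Filter.Tendsto (fun ε : ℝ => ε * (Q i - Q (i + 1))) (nhds 0) (nhds 0) := by
          have : Continuous fun ε : ℝ => ε * (Q i - Q (i + 1)) := by fun_prop
          simpa using this.tendsto 0
        exact ((ht.mono_left nhdsWithin_le_nhds).eventually_lt_const hpos).mono fun _ h => h.le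
    exact (hev.and self_mem_nhdsWithin).exists
  set v : ℕ × ℕ × ℕ → ℝ := fun t => if t ∈ sumTriples s then w t + ε * w' t else 0 with hv
  have hv0 : ∀ t, 0 ≤ v t := fun t => by
    simp only [hv]
    split_ifs
    · exact add_nonneg (hw0 t) (mul_nonneg hε0.le (hw'0 t))
    · exact le_rfl
  have hMv : ∀ i, M v i = M w i + ε * Q i := fun i => by
    simp only [hM, ← hw', Finset.mul_sum, ← Finset.sum_add_distrib]
    refine Finset.sum_congr rfl fun t ht => ?_
    simp only [hv, if_pos ht]
    ring
  have hvd : ∀ i, M v i - M v (i + 1) ≤ ψ i - ψ (i + 1) := fun i => by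
    rw [hMv, hMv]
    by_cases hi : i ≤ s
    · have := hε i (Finset.mem_range.2 (by omega))
      simp only [hRdef] at this
      linarith
    · have := hwK.2 i
      rw [hQs i (by omega), hQs (i + 1) (by omega)]
      linarith
  have hvK : v ∈ K := by
    refine ⟨fun t _ => ⟨hv0 t, ?_⟩, hvd⟩
    by_cases ht : t ∈ sumTriples s
    · have h1 : v t ≤ M v t.1 := by
        have h2 : v t * coordCount t t.1 ≤ M v t.1 :=
          Finset.single_le_sum (f := fun t' => v t' * coordCount t' t.1)
            (fun t' _ => mul_nonneg (hv0 t') (coordCount_nonneg t' _)) ht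
        exact (le_mul_of_one_le_right (hv0 t) (one_le_coordCount_fst t)).trans h2
      have h3 : 0 ≤ ψ t.1 - M v t.1 := by
        refine nonneg_of_antitone (R := fun i => ψ i - M v i) (s := s)
          (antitone_nat_of_succ_le fun i => ?_) (fun i hi => ?_) t.1
        · have := hvd i
          linarith
        · rw [hs i hi, (hMt v hv0).eq_zero_of_lt hi, sub_zero]
      have h4 := hψ (Nat.zero_le t.1)
      linarith
    · simp only [hv, if_neg ht]
      exact hψ0 0
  have hle : ∑ t ∈ sumTriples s, v t ≤ ∑ t ∈ sumTriples s, w t := hmax hvK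
  have heq : ∑ t ∈ sumTriples s, v t =
      ∑ t ∈ sumTriples s, w t + ε * ∑ t ∈ sumTriples s, w' t := by
    rw [Finset.mul_sum, ← Finset.sum_add_distrib]
    exact Finset.sum_congr rfl fun t ht => by simp only [hv, if_pos ht]
  have hsum : ∑ t ∈ sumTriples s, w' t ≤ 0 := by
    by_contra! h
    have := mul_pos hε0 h
    linarith
  refine hi₀ ?_
  rw [← hw']
  refine Finset.sum_eq_zero fun t ht => ?_
  have h1 : w' t ≤ ∑ t ∈ sumTriples s, w' t :=
    Finset.single_le_sum (f := w') (fun t _ => hw'0 t) ht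
  rw [le_antisymm (h1.trans hsum) (hw'0 t), zero_mul]

/-- A nonincreasing function on `[0, s]` with mean `s / 3` is the sum of the three coordinate
marginals of a nonnegative weight on the triples with sum `s`. -/
theorem isTripleMarginal_of_antitone (s : ℕ) : ∀ {ψ : ℕ → ℝ}, Antitone ψ →
    (∀ i, s < i → ψ i = 0) →
    ∑ i ∈ Finset.range (s + 1), (3 * (i : ℝ) - s) * ψ i = 0 → IsTripleMarginal s ψ := by
  induction s using Nat.strong_induction_on with
  | _ s ih =>
  refine isTripleMarginal_of_step fun R hR hs hmean hne => ?_
  obtain ⟨x, y, hx, hy, hys, hRx, hRy⟩ := exists_descents hR hs hmean hne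
  suffices h : ∃ Q, IsTripleMarginal s Q ∧ (∃ i, Q i ≠ 0) ∧
      ∀ i, i ≠ x → i ≠ y → Q i ≤ Q (i + 1) by
    obtain ⟨Q, h1, h2, h3⟩ := h
    exact ⟨Q, h1, h2, fun i hi => h3 i (fun h => hRx (h ▸ hi)) (fun h => hRy (h ▸ hi))⟩
  by_cases hxs : 2 * x ≤ s
  · rcases le_total (x + y) s with h | h
    · exact exists_marginal_of_add_le h hy
    · exact exists_marginal_of_le_add h hxs hys
  rcases eq_or_lt_of_le hx with hx3 | hx3
  · obtain ⟨h, rfl⟩ : ∃ h, s = 3 * h := ⟨s / 3, by omega⟩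
    obtain rfl : x = 2 * h := by omega
    refine ⟨_, isTripleMarginal_intervalInd h, ⟨0, by simp [intervalInd]⟩, fun i hi _ => ?_⟩
    exact mul_le_mul_of_nonneg_left (intervalInd_le_succ hi) (by norm_num)
  -- reflecting `[0, x]` turns the sum `s` into `s' = 3x - s`, which is smaller
  obtain ⟨s', hs'⟩ : ∃ s', s + s' = 3 * x := ⟨3 * x - s, by omega⟩
  have hs'0 : (0 : ℝ) < s' := by exact_mod_cast (show 0 < s' by omega)
  set c : ℝ := (x + 1) * (3 * x - 2 * s') / (2 * s') with hc
  have hc0 : 0 ≤ c := by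
    have : (2 * s' : ℝ) ≤ 3 * x := by exact_mod_cast (show 2 * s' ≤ 3 * x by omega)
    exact div_nonneg (mul_nonneg (by positivity) (by linarith)) (by positivity)
  have hps : ∀ n : ℕ, ∑ i ∈ Finset.range (n + 1), (3 * (i : ℝ) - s') =
      (n + 1) * (3 * n - 2 * s') / 2 := by
    intro n
    induction n with
    | zero =>
      simp
      ring
    | succ n ihn =>
      rw [Finset.sum_range_succ, ihn]
      push_cast
      ring
  have key := ih s' (by omega) (ψ := fun i => intervalInd 0 x i + c * (if i = 0 then 1 else 0))
    (antitone_nat_of_succ_le fun i => by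
      have h1 : intervalInd 0 x (i + 1) ≤ intervalInd 0 x i := by
        unfold intervalInd
        split_ifs <;> first | omega | norm_num
      have h2 : 0 ≤ c * (if i = 0 then 1 else 0) := by positivity
      rw [if_neg (Nat.succ_ne_zero i)]
      linarith)
    (fun i hi => by
      unfold intervalInd
      rw [if_neg (by omega), if_neg (by omega)]
      simp)
    (by
      simp only [mul_add, Finset.sum_add_distrib]
      have h1 : ∑ i ∈ Finset.range (s' + 1), (3 * (i : ℝ) - s') * intervalInd 0 x i =
          (x + 1) * (3 * x - 2 * s') / 2 := by
        rw [← hps x]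
        symm
        refine Finset.sum_subset_zero_on_sdiff (Finset.range_mono (by omega)) ?_ ?_
        · intro i hi
          rw [Finset.mem_sdiff, Finset.mem_range, Finset.mem_range] at hi
          unfold intervalInd
          rw [if_neg (by omega), mul_zero]
        · intro i hi
          rw [Finset.mem_range] at hi
          unfold intervalInd
          rw [if_pos (by omega), mul_one]
      have h2 : ∑ i ∈ Finset.range (s' + 1), (3 * (i : ℝ) - s') * (c * (if i = 0 then 1 else 0)) =
          - s' * c := by
        rw [Finset.sum_eq_single 0]
        · simp
        · intro i _ hi
          rw [if_neg hi]
          simp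
        · simp
      rw [h1, h2, hc]
      field_simp
      ring)
  refine ⟨_, key.reflect (x := x) hs' ?_, ⟨x, ?_⟩, fun i hix _ => ?_⟩
  · intro i hi
    unfold intervalInd
    rw [if_neg (by omega), if_neg (by omega)]
    simp
  · rw [if_pos le_rfl]
    simp only [Nat.sub_self, if_true, intervalInd]
    rw [if_pos (by omega)]
    positivity
  · by_cases hi : i ≤ x
    · have h2 : intervalInd 0 x (x - i) = 1 := if_pos (by omega)
      have h3 : intervalInd 0 x (x - (i + 1)) = 1 := if_pos (by omega)
      have h4 : ¬ x - i = 0 := by omega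
      have h5 : i + 1 ≤ x := by omega
      have h6 : 0 ≤ c * (if x - (i + 1) = 0 then 1 else 0) := by positivity
      simp only [if_pos hi, if_pos h5, h2, h3, if_neg h4, mul_zero, add_zero]
      linarith
    · have h5 : ¬ i + 1 ≤ x := by omega
      simp only [if_neg hi, if_neg h5, le_refl]

/-! ### Behrend's bound with the sharp constant -/

/-- Behrend's bound in terms of the real parameters `X = N ^ (1 / d)` and the number `d` of
digits. -/
theorem rothNumberNat_ge_of_digits {N d : ℕ} (hd : 2 ≤ d) (hN : 1 ≤ N) {X : ℝ}
    (hX : X ^ d = N) (hXd : 2 * d ≤ X) :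
    (N : ℝ) * ((2 : ℝ) ^ d * X ^ 2 * (2 * d))⁻¹ ≤ rothNumberNat N := by
  have hd0 : (0 : ℝ) < d := by positivity
  have hX0 : 0 < X := by linarith
  have hd2 : (2 : ℝ) ≤ d := by exact_mod_cast hd
  set m : ℕ := ⌊(X + 1) / 2⌋₊ with hm
  have hm1 : (m : ℝ) ≤ (X + 1) / 2 := Nat.floor_le (by linarith)
  have hm2 : (X - 1) / 2 ≤ m := by
    have := Nat.lt_floor_add_one ((X + 1) / 2)
    rw [← hm] at this
    linarith
  have hm0 : m ≠ 0 := by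
    rintro h
    rw [h] at hm2
    push_cast at hm2
    linarith
  have hmono : ((2 * m - 1) ^ d : ℕ) ≤ N := by
    have : (((2 * m - 1) ^ d : ℕ) : ℝ) ≤ N := by
      rw [← hX]
      push_cast [Nat.cast_sub (show 1 ≤ 2 * m by omega)]
      refine pow_le_pow_left₀ ?_ (by linarith) d
      have : (1 : ℝ) ≤ m := by exact_mod_cast Nat.one_le_iff_ne_zero.2 hm0
      linarith
    exact_mod_cast this
  have hB := Behrend.bound_aux' d m
  have hR : (rothNumberNat ((2 * m - 1) ^ d) : ℝ) ≤ rothNumberNat N := by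
    exact_mod_cast rothNumberNat.monotone hmono
  refine le_trans ?_ (hB.trans hR)
  push_cast
  have h1 : (N : ℝ) * 2⁻¹ ≤ 2 ^ d * (m : ℝ) ^ d := by
    have h2 : 1 + (d : ℝ) * (-(1 / X)) ≤ (1 + -(1 / X)) ^ d := by
      refine one_add_mul_le_pow ?_ d
      have : 1 / X ≤ 1 := by
        rw [div_le_one hX0]
        linarith
      linarith
    have h3 : (d : ℝ) * (1 / X) ≤ 1 / 2 := by
      rw [mul_one_div, div_le_div_iff₀ hX0 two_pos]
      linarith
    have h4 : (X - 1) ^ d ≤ 2 ^ d * (m : ℝ) ^ d := by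
      rw [← mul_pow]
      exact pow_le_pow_left₀ (by linarith) (by linarith) d
    have h5 : (X - 1) ^ d = N * (1 + -(1 / X)) ^ d := by
      rw [← hX, ← mul_pow]
      congr 1
      field_simp
      ring
    have h6 : (N : ℝ) * 2⁻¹ ≤ N * (1 + -(1 / X)) ^ d :=
      mul_le_mul_of_nonneg_left (by linarith) (Nat.cast_nonneg N)
    linarith
  have hm' : (0 : ℝ) < m := by positivity
  have h7 : (m : ℝ) ^ 2 ≤ X ^ 2 := pow_le_pow_left₀ hm'.le (by linarith) 2
  calc (N : ℝ) * ((2 : ℝ) ^ d * X ^ 2 * (2 * d))⁻¹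
      = (N * 2⁻¹) * ((2 : ℝ) ^ d * X ^ 2 * d)⁻¹ := by
        field_simp
    _ ≤ (2 ^ d * (m : ℝ) ^ d) * ((2 : ℝ) ^ d * X ^ 2 * d)⁻¹ := by gcongr
    _ = (m : ℝ) ^ d * (X ^ 2 * d)⁻¹ := by field_simp
    _ ≤ (m : ℝ) ^ d * ((m : ℝ) ^ 2 * d)⁻¹ := by gcongr
    _ = (m : ℝ) ^ d / (d * m ^ 2) := by rw [mul_comm (d : ℝ), div_eq_mul_inv]

/-- Behrend's theorem with the constant `2 √(2 log 2)`. -/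
theorem exists_rothNumberNat_ge : ∃ A : ℝ, 0 < A ∧ ∀ N : ℕ, 1 ≤ N →
    N * Real.exp (-(2 * Real.sqrt (2 * Real.log 2 * Real.log N))) / (A * (1 + Real.log N)) ≤
      rothNumberNat N := by
  have hl2 : 0 < Real.log 2 := Real.log_pos one_lt_two
  -- the optimal number of digits is about `τ = √(2 log N / log 2)`
  have hlim : ∀ᶠ N : ℕ in Filter.atTop, 2 ≤ Real.sqrt (2 * Real.log N / Real.log 2) ∧
      2 * (Real.sqrt (2 * Real.log N / Real.log 2) + 1) ≤
        Real.exp (Real.log 2 / 4 * Real.sqrt (2 * Real.log N / Real.log 2)) := by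
    have h1 : Filter.Tendsto (fun N : ℕ => Real.sqrt (2 * Real.log N / Real.log 2)) Filter.atTop
        Filter.atTop := by
      refine Real.tendsto_sqrt_atTop.comp ?_
      refine Filter.Tendsto.atTop_div_const hl2 ?_
      exact (Real.tendsto_log_atTop.comp tendsto_natCast_atTop_atTop).const_mul_atTop two_pos
    have h2 : ∀ᶠ t : ℝ in Filter.atTop, 2 * (t + 1) ≤ Real.exp (Real.log 2 / 4 * t) := by
      have h3 : (fun t : ℝ => 2 * (t + 1)) =o[Filter.atTop]
          fun t => Real.exp (Real.log 2 / 4 * t) := by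
        refine Asymptotics.IsLittleO.const_mul_left ?_ 2
        refine Asymptotics.IsLittleO.add ?_ ?_
        · simpa using isLittleO_pow_exp_pos_mul_atTop (k := 1) (b := Real.log 2 / 4) (by positivity)
        · simpa using isLittleO_pow_exp_pos_mul_atTop (k := 0) (b := Real.log 2 / 4) (by positivity)
      filter_upwards [h3.bound one_pos] with t ht
      rw [one_mul, Real.norm_eq_abs, Real.norm_eq_abs, Real.abs_exp] at ht
      exact (le_abs_self _).trans ht
    exact (h1.eventually_ge_atTop 2).and (h1.eventually h2)
  obtain ⟨N₀, hN₀⟩ := Filter.eventually_atTop.1 hlim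
  have hA0 : (0 : ℝ) < max (N₀ : ℝ) (16 / Real.log 2 + 8) :=
    lt_max_of_lt_right (by positivity)
  refine ⟨max (N₀ : ℝ) (16 / Real.log 2 + 8), hA0, fun N hN => ?_⟩
  have hlog : 0 ≤ Real.log N := Real.log_natCast_nonneg N
  have hroth : (1 : ℝ) ≤ rothNumberNat N := by
    have h1 : rothNumberNat 1 ≤ rothNumberNat N := rothNumberNat.monotone hN
    have h2 : rothNumberNat 1 = 1 := by decide
    exact_mod_cast h2 ▸ h1
  rcases lt_or_ge N N₀ with hlt | hge
  · refine le_trans ?_ hroth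
    rw [div_le_one (by positivity)]
    have h1 : Real.exp (-(2 * Real.sqrt (2 * Real.log 2 * Real.log N))) ≤ 1 :=
      Real.exp_le_one_iff.2 (by have := Real.sqrt_nonneg (2 * Real.log 2 * Real.log N); linarith)
    have h2 : (N : ℝ) ≤ max (N₀ : ℝ) (16 / Real.log 2 + 8) :=
      le_max_of_le_left (by exact_mod_cast hlt.le)
    calc (N : ℝ) * _ ≤ N * 1 := by gcongr
      _ ≤ max (N₀ : ℝ) (16 / Real.log 2 + 8) * (1 + Real.log N) := by
        refine mul_le_mul h2 (by linarith) zero_le_one hA0.le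
  obtain ⟨ht1, ht2⟩ := hN₀ N hge
  set τ := Real.sqrt (2 * Real.log N / Real.log 2) with hτ
  have hτsq : τ ^ 2 * Real.log 2 = 2 * Real.log N := by
    rw [hτ, Real.sq_sqrt (by positivity)]
    field_simp
  have hexp : Real.sqrt (2 * Real.log 2 * Real.log N) = τ * Real.log 2 := by
    rw [Real.sqrt_eq_iff_mul_self_eq (by positivity) (by positivity)]
    linear_combination (-Real.log 2) * hτsq
  set d : ℕ := ⌈τ⌉₊ with hd
  have hd1 : τ ≤ d := Nat.le_ceil τ
  have hd2 : (d : ℝ) ≤ τ + 1 := (Nat.ceil_lt_add_one (show 0 ≤ τ by linarith)).le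
  have hd0 : (0 : ℝ) < d := by linarith
  have hdtwo : 2 ≤ d := by exact_mod_cast ht1.trans hd1
  have hN0 : (0 : ℝ) < N := by exact_mod_cast hN
  have hX : Real.exp (Real.log N / d) ^ d = N := by
    rw [← Real.exp_nat_mul, mul_div_cancel₀ _ hd0.ne', Real.exp_log hN0]
  have hXd : 2 * (d : ℝ) ≤ Real.exp (Real.log N / d) := by
    refine le_trans (by linarith) (ht2.trans (Real.exp_le_exp.2 ?_))
    rw [le_div_iff₀ hd0]
    nlinarith
  refine le_trans ?_ (rothNumberNat_ge_of_digits hdtwo hN hX hXd)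
  rw [div_eq_mul_inv, mul_assoc, hexp]
  refine mul_le_mul_of_nonneg_left ?_ hN0.le
  rw [Real.exp_neg, ← mul_inv]
  refine inv_anti₀ (by positivity) ?_
  have h1 : (2 : ℝ) ^ d ≤ Real.exp (τ * Real.log 2) * 2 := by
    calc (2 : ℝ) ^ d = Real.exp (d * Real.log 2) := by
          rw [Real.exp_nat_mul, Real.exp_log two_pos]
      _ ≤ Real.exp (τ * Real.log 2 + Real.log 2) := Real.exp_le_exp.2 (by nlinarith)
      _ = Real.exp (τ * Real.log 2) * 2 := by rw [Real.exp_add, Real.exp_log two_pos]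
  have h2 : Real.exp (Real.log N / d) ^ 2 ≤ Real.exp (τ * Real.log 2) := by
    rw [← Real.exp_nat_mul]
    refine Real.exp_le_exp.2 ?_
    push_cast
    rw [← mul_div_assoc, div_le_iff₀ hd0]
    nlinarith [mul_le_mul_of_nonneg_left hd1 (show 0 ≤ τ * Real.log 2 by positivity)]
  have h3 : 2 * (2 * (d : ℝ)) ≤ max (N₀ : ℝ) (16 / Real.log 2 + 8) * (1 + Real.log N) := by
    have h4 : (16 / Real.log 2 + 8) * (1 + Real.log N) ≤
        max (N₀ : ℝ) (16 / Real.log 2 + 8) * (1 + Real.log N) := by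
      gcongr
      exact le_max_right _ _
    refine le_trans ?_ h4
    have h5 : τ ^ 2 = 2 * Real.log N / Real.log 2 := by
      field_simp
      linarith
    have h6 : 16 / Real.log 2 * Real.log N = 8 * τ ^ 2 := by
      rw [h5]
      ring
    have h7 : 0 < 16 / Real.log 2 := by positivity
    nlinarith
  calc (2 : ℝ) ^ d * Real.exp (Real.log N / d) ^ 2 * (2 * d)
      ≤ (Real.exp (τ * Real.log 2) * 2) * Real.exp (τ * Real.log 2) * (2 * d) := by gcongr
    _ = Real.exp (2 * (τ * Real.log 2)) * (2 * (2 * d)) := by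
        rw [two_mul (τ * Real.log 2), Real.exp_add]
        ring
    _ ≤ _ := by gcongr

/-! ### Random affine hashing -/

section Hashing

variable {F ι : Type*} [Field F] [DecidableEq F] [Fintype ι]

/-- Two triples agree in one of their coordinates. -/
def SharesCoord {A : Type*} (x y : A × A × A) : Prop :=
  x.1 = y.1 ∨ x.2.1 = y.2.1 ∨ x.2.2 = y.2.2

/-- The triples of `X` whose three coordinates are hashed into `R`. The hash functions are
`a ↦ α ⬝ a + β`, `b ↦ α ⬝ b + γ` and `c ↦ (α ⬝ (u - c) + β + γ) / 2`, so that the three values at a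
triple with sum `u` form an arithmetic progression. -/
def hashed (u : ι → F) (X : Finset ((ι → F) × (ι → F) × (ι → F))) (R : Finset F)
    (p : (ι → F) × F × F) : Finset ((ι → F) × (ι → F) × (ι → F)) :=
  X.filter fun x => p.1 ⬝ᵥ x.1 + p.2.1 ∈ R ∧ p.1 ⬝ᵥ x.2.1 + p.2.2 ∈ R ∧
    (p.1 ⬝ᵥ (u - x.2.2) + p.2.1 + p.2.2) / 2 ∈ R

variable {u : ι → F} {X : Finset ((ι → F) × (ι → F) × (ι → F))} {R : Finset F}

/-- If the three hash values of a triple lie in `R`, then they are equal, as they form an arithmetic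
progression. -/
theorem mem_hashed_iff (h2 : (2 : F) ≠ 0) (hX : ∀ x ∈ X, x.1 + x.2.1 + x.2.2 = u)
    (hR : ThreeAPFree (R : Set F)) {p : (ι → F) × F × F} {x : (ι → F) × (ι → F) × (ι → F)} :
    x ∈ hashed u X R p ↔ x ∈ X ∧ ∃ r ∈ R, p.1 ⬝ᵥ x.1 + p.2.1 = r ∧ p.1 ⬝ᵥ x.2.1 + p.2.2 = r ∧
      (p.1 ⬝ᵥ (u - x.2.2) + p.2.1 + p.2.2) / 2 = r := by
  unfold hashed
  rw [Finset.mem_filter]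
  refine and_congr_right fun hx => ⟨?_, ?_⟩
  · rintro ⟨h₁, h₂, h₃⟩
    have hsum : p.1 ⬝ᵥ (u - x.2.2) = p.1 ⬝ᵥ x.1 + p.1 ⬝ᵥ x.2.1 := by
      rw [← hX x hx, add_sub_cancel_right, dotProduct_add]
    have h12 : (p.1 ⬝ᵥ x.1 + p.2.1) + (p.1 ⬝ᵥ x.2.1 + p.2.2) =
        (p.1 ⬝ᵥ (u - x.2.2) + p.2.1 + p.2.2) / 2 + (p.1 ⬝ᵥ (u - x.2.2) + p.2.1 + p.2.2) / 2 := by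
      rw [← two_mul, mul_div_cancel₀ _ h2, hsum]
      ring
    have e1 := hR h₁ h₃ h₂ h12
    have e2 := hR h₂ h₃ h₁ (by rw [add_comm, h12])
    exact ⟨_, h₃, e1, e2, rfl⟩
  · rintro ⟨r, hr, h₁, h₂, h₃⟩
    rw [h₁, h₂, h₃]
    exact ⟨hr, hr, hr⟩

variable [Fintype F] [DecidableEq ι]

theorem card_dotProduct_eq_zero_mul_le {v : ι → F} (hv : v ≠ 0) :
    (Finset.univ.filter fun α : ι → F => α ⬝ᵥ v = 0).card * Fintype.card F ≤
      Fintype.card (ι → F) := by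
  obtain ⟨j, hj⟩ := Function.ne_iff.1 hv
  rw [← Finset.card_univ (α := F), ← Finset.card_product, ← Finset.card_univ]
  refine Finset.card_le_card_of_injOn (fun p => p.1 + Pi.single j p.2) (fun _ _ => by simp) ?_
  rintro ⟨α, c⟩ hα ⟨α', c'⟩ hα' h
  simp only [Finset.coe_product, Finset.coe_filter, Finset.mem_univ, true_and, Finset.coe_univ,
    Set.mem_prod, Set.mem_ofPred_eq, Set.mem_univ, and_true] at hα hα'
  dsimp only at h
  have h1 := congrArg (· ⬝ᵥ v) h
  simp only [add_dotProduct, hα, hα', single_dotProduct, zero_add] at h1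
  obtain rfl : c = c' := mul_right_cancel₀ hj h1
  simpa using h

/-- A triple is hashed into `R` with probability at least `|R| / |F| ^ 2`: every constant
progression is attained, for all choices of `α`. -/
theorem card_mul_le_card_mem_hashed (h2 : (2 : F) ≠ 0) (hX : ∀ x ∈ X, x.1 + x.2.1 + x.2.2 = u)
    (hR : ThreeAPFree (R : Set F)) {x : (ι → F) × (ι → F) × (ι → F)} (hx : x ∈ X) :
    Fintype.card (ι → F) * R.card ≤ (Finset.univ.filter fun p => x ∈ hashed u X R p).card := by
  rw [← Finset.card_univ, ← Finset.card_product]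
  refine Finset.card_le_card_of_injOn
    (fun q => (q.1, q.2 - q.1 ⬝ᵥ x.1, q.2 - q.1 ⬝ᵥ x.2.1)) ?_ ?_
  · rintro ⟨α, r⟩ hr
    rw [Finset.mem_coe, Finset.mem_product] at hr
    simp only [Finset.coe_filter, Finset.mem_univ, true_and, Set.mem_ofPred_eq]
    rw [mem_hashed_iff h2 hX hR]
    refine ⟨hx, r, hr.2, by simp, by simp, ?_⟩
    rw [← hX x hx, add_sub_cancel_right, dotProduct_add, div_eq_iff h2]
    ring
  · rintro ⟨α, r⟩ - ⟨α', r'⟩ - h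
    simp only [Prod.mk.injEq] at h
    obtain ⟨rfl, h, -⟩ := h
    rw [sub_left_inj] at h
    rw [h]

/-- Two distinct triples that share a coordinate are both hashed into `R` with probability at most
`|R| / |F| ^ 3`. -/
theorem card_pair_mem_hashed_mul_le (h2 : (2 : F) ≠ 0) (hX : ∀ x ∈ X, x.1 + x.2.1 + x.2.2 = u)
    (hR : ThreeAPFree (R : Set F)) {x y : (ι → F) × (ι → F) × (ι → F)} (hx : x ∈ X) (hy : y ∈ X)
    (hxy : x ≠ y) (hs : SharesCoord x y) :
    (Finset.univ.filter fun p => x ∈ hashed u X R p ∧ y ∈ hashed u X R p).card * Fintype.card F ≤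
      Fintype.card (ι → F) * R.card := by
  -- both triples are hashed to the same constant progression
  have same : ∀ p, x ∈ hashed u X R p → y ∈ hashed u X R p → p.1 ⬝ᵥ (x.1 - y.1) = 0 ∧
      p.1 ⬝ᵥ (x.2.1 - y.2.1) = 0 ∧ p.1 ⬝ᵥ x.1 + p.2.1 ∈ R ∧
      p.1 ⬝ᵥ x.2.1 + p.2.2 = p.1 ⬝ᵥ x.1 + p.2.1 := by
    intro p hpx hpy
    rw [mem_hashed_iff h2 hX hR] at hpx hpy
    obtain ⟨-, r, hr, h₁, h₂, h₃⟩ := hpx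
    obtain ⟨-, r', -, h₁', h₂', h₃'⟩ := hpy
    have : r = r' := by
      rcases hs with h | h | h
      · rw [← h₁, ← h₁', h]
      · rw [← h₂, ← h₂', h]
      · rw [← h₃, ← h₃', h]
    subst this
    rw [dotProduct_sub, dotProduct_sub]
    refine ⟨?_, ?_, h₁ ▸ hr, h₂.trans h₁.symm⟩
    · rw [sub_eq_zero]
      exact add_right_cancel (h₁.trans h₁'.symm)
    · rw [sub_eq_zero]
      exact add_right_cancel (h₂.trans h₂'.symm)
  obtain ⟨v, hv, hvp⟩ : ∃ v : ι → F, v ≠ 0 ∧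
      ∀ p, x ∈ hashed u X R p → y ∈ hashed u X R p → p.1 ⬝ᵥ v = 0 := by
    by_cases h1 : x.1 - y.1 = 0
    · refine ⟨x.2.1 - y.2.1, fun h3 => hxy ?_, fun p hp hp' => (same p hp hp').2.1⟩
      rw [sub_eq_zero] at h1 h3
      have h4 := (hX x hx).trans (hX y hy).symm
      rw [h1, h3] at h4
      exact Prod.ext h1 (Prod.ext h3 (add_left_cancel h4))
    · exact ⟨_, h1, fun p hp hp' => (same p hp hp').1⟩
  have hle : (Finset.univ.filter fun p => x ∈ hashed u X R p ∧ y ∈ hashed u X R p).card ≤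
      (Finset.univ.filter fun α : ι → F => α ⬝ᵥ v = 0).card * R.card := by
    rw [← Finset.card_product]
    refine Finset.card_le_card_of_injOn (fun p => (p.1, p.1 ⬝ᵥ x.1 + p.2.1)) ?_ ?_
    · intro p hp
      simp only [Finset.coe_filter, Finset.mem_univ, true_and, Set.mem_ofPred_eq] at hp
      simp only [Finset.coe_product, Finset.coe_filter, Finset.mem_univ, true_and, Set.mem_prod,
        Set.mem_ofPred_eq, Finset.mem_coe]
      exact ⟨hvp p hp.1 hp.2, (same p hp.1 hp.2).2.2.1⟩
    · rintro ⟨α, β, γ⟩ hp ⟨α', β', γ'⟩ hp' h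
      simp only [Finset.coe_filter, Finset.mem_univ, true_and, Set.mem_ofPred_eq] at hp hp'
      have e := (same _ hp.1 hp.2).2.2.2
      have e' := (same _ hp'.1 hp'.2).2.2.2
      simp only [Prod.mk.injEq] at h e e' ⊢
      obtain ⟨rfl, h⟩ := h
      obtain rfl := add_left_cancel h
      exact ⟨rfl, rfl, add_left_cancel (e.trans e'.symm)⟩
  calc _ ≤ (Finset.univ.filter fun α : ι → F => α ⬝ᵥ v = 0).card * R.card * Fintype.card F :=
        Nat.mul_le_mul_right _ hle
    _ = (Finset.univ.filter fun α : ι → F => α ⬝ᵥ v = 0).card * Fintype.card F * R.card := by ring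
    _ ≤ _ := Nat.mul_le_mul_right _ (card_dotProduct_eq_zero_mul_le hv)

open Classical in
/-- Let `X` be a set of triples with sum `u`, in which every element occurs at most `D` times at
each position. For a random choice of the hash functions, the hashed triples that share no
coordinate with another hashed triple are numerous. -/
theorem exists_isolated_subset (h2 : (2 : F) ≠ 0) (hX : ∀ x ∈ X, x.1 + x.2.1 + x.2.2 = u)
    (hR : ThreeAPFree (R : Set F)) {D : ℕ}
    (hD₁ : ∀ x ∈ X, (X.filter fun y => x.1 = y.1).card ≤ D)
    (hD₂ : ∀ x ∈ X, (X.filter fun y => x.2.1 = y.2.1).card ≤ D)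
    (hD₃ : ∀ x ∈ X, (X.filter fun y => x.2.2 = y.2.2).card ≤ D)
    (hD : 6 * D ≤ Fintype.card F) :
    ∃ S ⊆ X, X.card * R.card ≤ 2 * Fintype.card F ^ 2 * S.card ∧
      ∀ x ∈ S, ∀ y ∈ S, ∀ z ∈ S, (x.1, y.2.1, z.2.2) ∈ X → x = y ∧ y = z := by
  set S : (ι → F) × F × F → Finset ((ι → F) × (ι → F) × (ι → F)) := fun p =>
    (hashed u X R p).filter fun x => ∀ y ∈ hashed u X R p, SharesCoord x y → x = y with hS
  set P := (X ×ˢ X).filter fun z => z.1 ≠ z.2 ∧ SharesCoord z.1 z.2 with hP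
  set L := Fintype.card (ι → F) with hL
  set f := Fintype.card F with hf
  have hf0 : 0 < f := Fintype.card_pos
  have hPcard : P.card ≤ X.card * (3 * D) := by
    have h1 : P ⊆ X.biUnion fun x => ((X.filter fun y => x.1 = y.1) ∪
        (X.filter fun y => x.2.1 = y.2.1) ∪ (X.filter fun y => x.2.2 = y.2.2)).image (x, ·) := by
      rintro ⟨x, y⟩ hz
      rw [hP, Finset.mem_filter, Finset.mem_product] at hz
      obtain ⟨⟨hx, hy⟩, -, hs⟩ := hz
      rw [Finset.mem_biUnion]
      refine ⟨x, hx, Finset.mem_image.2 ⟨y, ?_, rfl⟩⟩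
      simp only [Finset.mem_union, Finset.mem_filter]
      dsimp only at hy
      rcases hs with h | h | h
      · exact Or.inl (Or.inl ⟨hy, h⟩)
      · exact Or.inl (Or.inr ⟨hy, h⟩)
      · exact Or.inr ⟨hy, h⟩
    refine (Finset.card_le_card h1).trans (Finset.card_biUnion_le_card_mul _ _ _ fun x hx => ?_)
    refine Finset.card_image_le.trans ((Finset.card_union_le _ _).trans ?_)
    have := Finset.card_union_le (X.filter fun y => x.1 = y.1) (X.filter fun y => x.2.1 = y.2.1)
    have := hD₁ x hx
    have := hD₂ x hx
    have := hD₃ x hx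
    omega
  have hsplit : ∀ p, (hashed u X R p).card ≤ (S p).card +
      (P.filter fun z => z.1 ∈ hashed u X R p ∧ z.2 ∈ hashed u X R p).card := by
    intro p
    have h1 : hashed u X R p ⊆ S p ∪
        (P.filter fun z => z.1 ∈ hashed u X R p ∧ z.2 ∈ hashed u X R p).image Prod.fst := by
      intro x hx
      rw [Finset.mem_union]
      by_cases h : ∀ y ∈ hashed u X R p, SharesCoord x y → x = y
      · exact Or.inl (Finset.mem_filter.2 ⟨hx, h⟩)
      · push Not at h
        obtain ⟨y, hy, hs, hne⟩ := h
        have hsub : hashed u X R p ⊆ X := Finset.filter_subset _ _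
        exact Or.inr (Finset.mem_image.2 ⟨(x, y), Finset.mem_filter.2 ⟨Finset.mem_filter.2
          ⟨Finset.mem_product.2 ⟨hsub hx, hsub hy⟩, hne, hs⟩, hx, hy⟩, rfl⟩)
    exact (Finset.card_le_card h1).trans ((Finset.card_union_le _ _).trans
      (Nat.add_le_add_left Finset.card_image_le _))
  have hfirst : X.card * (L * R.card) ≤ ∑ p, (hashed u X R p).card := by
    have h1 : ∀ p, (hashed u X R p).card = ∑ x ∈ X, if x ∈ hashed u X R p then 1 else 0 := by
      intro p
      rw [← Finset.card_filter]
      congr 1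
      ext x
      rw [Finset.mem_filter]
      exact ⟨fun h => ⟨Finset.filter_subset _ _ h, h⟩, fun h => h.2⟩
    simp only [h1]
    rw [Finset.sum_comm, ← smul_eq_mul]
    refine Finset.card_nsmul_le_sum _ _ _ fun x hx => ?_
    rw [← Finset.card_filter]
    exact card_mul_le_card_mem_hashed h2 hX hR hx
  have hsecond : 2 * ∑ p, (P.filter fun z => z.1 ∈ hashed u X R p ∧
      z.2 ∈ hashed u X R p).card ≤ X.card * (L * R.card) := by
    have h1 : (∑ p, (P.filter fun z => z.1 ∈ hashed u X R p ∧ z.2 ∈ hashed u X R p).card) * f ≤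
        P.card * (L * R.card) := by
      simp only [Finset.card_filter _ P]
      rw [Finset.sum_comm, Finset.sum_mul, ← smul_eq_mul]
      refine Finset.sum_le_card_nsmul _ _ _ fun z hz => ?_
      rw [← Finset.card_filter]
      rw [hP, Finset.mem_filter, Finset.mem_product] at hz
      exact card_pair_mem_hashed_mul_le h2 hX hR hz.1.1 hz.1.2 hz.2.1 hz.2.2
    refine Nat.le_of_mul_le_mul_right ?_ hf0
    calc _ = 2 * ((∑ p, (P.filter fun z => z.1 ∈ hashed u X R p ∧
          z.2 ∈ hashed u X R p).card) * f) := by ring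
      _ ≤ 2 * (X.card * (3 * D) * (L * R.card)) :=
          Nat.mul_le_mul_left 2 (h1.trans (Nat.mul_le_mul_right _ hPcard))
      _ = X.card * (L * R.card) * (6 * D) := by ring
      _ ≤ X.card * (L * R.card) * f := Nat.mul_le_mul_left _ hD
  have hsum : ∑ _p : (ι → F) × F × F, X.card * R.card ≤ ∑ p, 2 * f ^ 2 * (S p).card := by
    have h1 := Finset.sum_le_sum fun p (_ : p ∈ Finset.univ) => hsplit p
    rw [Finset.sum_add_distrib] at h1
    rw [Finset.sum_const, Finset.card_univ, Fintype.card_prod, Fintype.card_prod, ← hf, ← hL,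
      smul_eq_mul, ← Finset.mul_sum]
    calc L * (f * f) * (X.card * R.card) = f ^ 2 * (X.card * (L * R.card)) := by ring
      _ ≤ f ^ 2 * (2 * ∑ p, (S p).card) := Nat.mul_le_mul_left _ (by omega)
      _ = _ := by ring
  obtain ⟨p, -, hp⟩ := Finset.exists_le_of_sum_le Finset.univ_nonempty hsum
  refine ⟨S p, (Finset.filter_subset _ _).trans (Finset.filter_subset _ _), hp, ?_⟩
  intro x hx y hy z hz hw
  rw [hS, Finset.mem_filter] at hx hy hz
  have hwp : (x.1, y.2.1, z.2.2) ∈ hashed u X R p :=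
    Finset.mem_filter.2 ⟨hw, (Finset.mem_filter.1 hx.1).2.1, (Finset.mem_filter.1 hy.1).2.2.1,
      (Finset.mem_filter.1 hz.1).2.2.2⟩
  have e1 := hx.2 _ hwp (Or.inl rfl)
  have e2 := hy.2 _ hwp (Or.inr (Or.inl rfl))
  have e3 := hz.2 _ hwp (Or.inr (Or.inr rfl))
  exact ⟨e1.trans e2.symm, e2.trans e3.symm⟩

end Hashing

/-! ### Words with prescribed letter counts -/

section Words

variable {ι A : Type*} [Fintype ι] [DecidableEq ι] [DecidableEq A]

/-- The words that are rearrangements of the word `w`. -/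
def rearrangements (w : ι → A) : Finset (ι → A) :=
  Finset.univ.image fun σ : Equiv.Perm ι => w ∘ σ

theorem mem_rearrangements {w a : ι → A} :
    a ∈ rearrangements w ↔ ∃ σ : Equiv.Perm ι, w ∘ σ = a := by
  simp [rearrangements]

theorem comp_mem_rearrangements {w a : ι → A} (ha : a ∈ rearrangements w) (σ : Equiv.Perm ι) :
    a ∘ σ ∈ rearrangements w := by
  obtain ⟨τ, rfl⟩ := mem_rearrangements.1 ha
  exact mem_rearrangements.2 ⟨τ * σ, by ext; simp⟩

theorem self_mem_rearrangements (w : ι → A) : w ∈ rearrangements w :=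
  mem_rearrangements.2 ⟨1, rfl⟩

theorem sum_of_mem_rearrangements {M : Type*} [AddCommMonoid M] {w a : ι → A}
    (ha : a ∈ rearrangements w) (f : A → M) : ∑ i, f (a i) = ∑ i, f (w i) := by
  obtain ⟨σ, rfl⟩ := mem_rearrangements.1 ha
  exact Equiv.sum_comp σ fun i => f (w i)

theorem card_rearrangements_mul [Fintype A] (w : ι → A) :
    (rearrangements w).card * ∏ j, (Fintype.card {i // w i = j}).factorial =
      (Fintype.card ι).factorial := by
  rw [← DomMulAct.stabilizer_card w, ← Fintype.card_perm, ← smul_eq_mul]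
  symm
  rw [← Finset.sum_const, ← Finset.card_univ (α := Equiv.Perm ι), Finset.card_eq_sum_card_fiberwise (f := fun σ : Equiv.Perm ι => w ∘ σ)
    (t := rearrangements w) (fun σ _ => mem_rearrangements.2 ⟨σ, rfl⟩)]
  refine Finset.sum_congr rfl fun a ha => ?_
  obtain ⟨τ, rfl⟩ := mem_rearrangements.1 ha
  rw [Fintype.card_subtype]
  refine Finset.card_bij' (fun σ _ => σ * τ⁻¹) (fun σ _ => σ * τ) ?_ ?_ ?_ ?_
  · intro σ hσ
    simp only [Finset.mem_filter, Finset.mem_univ, true_and] at hσ ⊢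
    ext i
    have := congrFun hσ (τ⁻¹ i)
    simpa using this
  · intro σ hσ
    simp only [Finset.mem_filter, Finset.mem_univ, true_and] at hσ ⊢
    ext i
    exact congrFun hσ (τ i)
  · intro σ _
    simp
  · intro σ _
    simp

end Words

section WordTriples

variable {ι : Type*} [Fintype ι] [DecidableEq ι] {q : ℕ}

/-- The triples of rearrangements of the word `w` whose letters add up to `q - 1` at each place. -/
def wordTriples (w : ι → Fin q) : Finset ((ι → Fin q) × (ι → Fin q) × (ι → Fin q)) :=
  (rearrangements w ×ˢ rearrangements w ×ˢ rearrangements w).filter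
    fun x => ∀ i, (x.1 i : ℕ) + x.2.1 i + x.2.2 i = q - 1

variable {w : ι → Fin q}

theorem mem_wordTriples {x : (ι → Fin q) × (ι → Fin q) × (ι → Fin q)} :
    x ∈ wordTriples w ↔ (x.1 ∈ rearrangements w ∧ x.2.1 ∈ rearrangements w ∧
      x.2.2 ∈ rearrangements w) ∧ ∀ i, (x.1 i : ℕ) + x.2.1 i + x.2.2 i = q - 1 := by
  simp [wordTriples]

/-- The number of triples with a given first word. -/
def tripleDegree (w a : ι → Fin q) : ℕ := ((wordTriples w).filter fun y => a = y.1).card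

theorem tripleDegree_comp_le (a : ι → Fin q) (σ : Equiv.Perm ι) :
    tripleDegree w a ≤ tripleDegree w (a ∘ σ) := by
  refine Finset.card_le_card_of_injOn (fun y => (y.1 ∘ σ, y.2.1 ∘ σ, y.2.2 ∘ σ)) ?_ ?_
  · intro y hy
    rw [Finset.mem_coe, Finset.mem_filter, mem_wordTriples] at hy ⊢
    obtain ⟨⟨⟨h1, h2, h3⟩, h4⟩, rfl⟩ := hy
    exact ⟨⟨⟨comp_mem_rearrangements h1 σ, comp_mem_rearrangements h2 σ,
      comp_mem_rearrangements h3 σ⟩, fun i => h4 (σ i)⟩, rfl⟩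
  · intro y _ y' _ h
    simp only [Prod.mk.injEq] at h
    have hs := σ.surjective
    exact Prod.ext (hs.injective_comp_right h.1) (Prod.ext (hs.injective_comp_right h.2.1)
      (hs.injective_comp_right h.2.2))

theorem tripleDegree_eq {a : ι → Fin q} (ha : a ∈ rearrangements w) :
    tripleDegree w a = tripleDegree w w := by
  obtain ⟨σ, rfl⟩ := mem_rearrangements.1 ha
  refine le_antisymm ?_ (tripleDegree_comp_le w σ)
  have := tripleDegree_comp_le (w := w) (w ∘ σ) σ⁻¹
  rwa [Function.comp_assoc, ← Equiv.Perm.coe_mul, mul_inv_cancel, Equiv.Perm.coe_one,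
    Function.comp_id] at this

theorem card_filter_snd_le {a : ι → Fin q} (ha : a ∈ rearrangements w) :
    ((wordTriples w).filter fun y => a = y.2.1).card ≤ tripleDegree w w := by
  rw [← tripleDegree_eq ha]
  refine Finset.card_le_card_of_injOn (fun y => (y.2.1, y.2.2, y.1)) ?_ ?_
  · intro y hy
    rw [Finset.mem_coe, Finset.mem_filter, mem_wordTriples] at hy ⊢
    obtain ⟨⟨⟨h1, h2, h3⟩, h4⟩, h5⟩ := hy
    exact ⟨⟨⟨h2, h3, h1⟩, fun i => by have := h4 i; dsimp only; omega⟩, h5⟩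
  · intro y _ y' _ h
    simp only [Prod.mk.injEq] at h
    exact Prod.ext h.2.2 (Prod.ext h.1 h.2.1)

theorem card_filter_thd_le {a : ι → Fin q} (ha : a ∈ rearrangements w) :
    ((wordTriples w).filter fun y => a = y.2.2).card ≤ tripleDegree w w := by
  rw [← tripleDegree_eq ha]
  refine Finset.card_le_card_of_injOn (fun y => (y.2.2, y.1, y.2.1)) ?_ ?_
  · intro y hy
    rw [Finset.mem_coe, Finset.mem_filter, mem_wordTriples] at hy ⊢
    obtain ⟨⟨⟨h1, h2, h3⟩, h4⟩, h5⟩ := hy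
    exact ⟨⟨⟨h3, h1, h2⟩, fun i => by have := h4 i; dsimp only; omega⟩, h5⟩
  · intro y _ y' _ h
    simp only [Prod.mk.injEq] at h
    exact Prod.ext h.2.1 (Prod.ext h.2.2 h.1)

theorem card_wordTriples (w : ι → Fin q) :
    (wordTriples w).card = (rearrangements w).card * tripleDegree w w := by
  rw [Finset.card_eq_sum_card_fiberwise (f := fun y => y.1) (t := rearrangements w)
    (fun y hy => (mem_wordTriples.1 hy).1.1), ← smul_eq_mul, ← Finset.sum_const]
  refine Finset.sum_congr rfl fun a ha => ?_
  rw [← tripleDegree_eq ha, tripleDegree]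
  congr 1
  exact Finset.filter_congr fun y _ => eq_comm

theorem tripleDegree_le_card (w : ι → Fin q) :
    tripleDegree w w ≤ (rearrangements w).card := by
  refine Finset.card_le_card_of_injOn (fun y => y.2.1) ?_ ?_
  · intro y hy
    exact (mem_wordTriples.1 (Finset.mem_filter.1 hy).1).1.2.1
  · intro y hy y' hy' h
    rw [Finset.mem_coe, Finset.mem_filter, mem_wordTriples] at hy hy'
    dsimp only at h
    have h1 : y.1 = y'.1 := hy.2.symm.trans hy'.2
    refine Prod.ext h1 (Prod.ext h (funext fun i => Fin.ext ?_))
    have e := hy.1.2 i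
    have e' := hy'.1.2 i
    rw [h1, h] at e
    omega

/-- If the letters of `w` have mean `(q - 1) / 3`, then a triple of rearrangements of `w` that adds
up to `-1` modulo `q` at each place adds up to `q - 1`: each sum is at least `q - 1`, and on average
they are equal to `q - 1`. -/
theorem mem_wordTriples_of_modEq (hw : 3 * ∑ i, (w i : ℕ) = Fintype.card ι * (q - 1))
    {a b c : ι → Fin q} (ha : a ∈ rearrangements w) (hb : b ∈ rearrangements w)
    (hc : c ∈ rearrangements w) (h : ∀ i, q ∣ (a i : ℕ) + b i + c i + 1) :
    (a, b, c) ∈ wordTriples w := by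
  have hle : ∀ i ∈ Finset.univ, q - 1 ≤ (a i : ℕ) + b i + c i := fun i _ => by
    have := Nat.le_of_dvd (Nat.succ_pos _) (h i)
    omega
  have hsum : ∑ _i : ι, (q - 1) = ∑ i, ((a i : ℕ) + b i + c i) := by
    rw [Finset.sum_add_distrib, Finset.sum_add_distrib,
      sum_of_mem_rearrangements ha (fun j : Fin q => (j : ℕ)),
      sum_of_mem_rearrangements hb (fun j : Fin q => (j : ℕ)),
      sum_of_mem_rearrangements hc (fun j : Fin q => (j : ℕ)), Finset.sum_const, Finset.card_univ,
      smul_eq_mul]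
    omega
  have := (Finset.sum_eq_sum_iff_of_le hle).1 hsum
  exact mem_wordTriples.2 ⟨⟨ha, hb, hc⟩, fun i => (this i (Finset.mem_univ i)).symm⟩

/-- Comparison with the product weight `ρ ^ (a₁ + a₂ + ⋯)`, which is constant on rearrangements. -/
theorem card_rearrangements_mul_pow_le {ρ : ℝ} (hρ : 0 < ρ) (w : ι → Fin q) :
    ((rearrangements w).card : ℝ) * ρ ^ (∑ i, (w i : ℕ)) ≤
      (∑ j ∈ Finset.range q, ρ ^ j) ^ Fintype.card ι := by
  have h1 : (∑ j ∈ Finset.range q, ρ ^ j) ^ Fintype.card ι =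
      ∑ a : ι → Fin q, ∏ i, ρ ^ (a i : ℕ) := by
    rw [← Fin.sum_univ_eq_sum_range, ← Finset.card_univ, ← Finset.prod_const,
      Fintype.prod_sum]
  rw [h1, ← nsmul_eq_mul, ← Finset.sum_const]
  calc _ = ∑ a ∈ rearrangements w, ∏ i, ρ ^ (a i : ℕ) := by
        refine Finset.sum_congr rfl fun a ha => ?_
        rw [Finset.prod_pow_eq_pow_sum, sum_of_mem_rearrangements ha (fun j : Fin q => (j : ℕ))]
    _ ≤ _ := Finset.sum_le_univ_sum_of_nonneg fun a =>
        Finset.prod_nonneg fun i _ => by positivity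

end WordTriples

/-! ### The size of a multinomial coefficient -/

theorem mul_log_sub_le_log_factorial (n : ℕ) :
    n * Real.log n - n ≤ Real.log n.factorial := by
  rcases Nat.eq_zero_or_pos n with rfl | hn
  · simp
  have hn0 : (0 : ℝ) < n := by exact_mod_cast hn
  have hf : (0 : ℝ) < n.factorial := by positivity
  have h := Real.pow_div_factorial_le_exp (n : ℝ) hn0.le n
  have h2 := Real.log_le_log (by positivity) h
  rw [Real.log_exp, Real.log_div (by positivity) hf.ne', Real.log_pow] at h2
  linarith

theorem log_factorial_le (v : ℕ) :
    Real.log v.factorial ≤ v * Real.log v - v + 2 * Real.log (v + 1) + 1 := by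
  induction v with
  | zero => simp
  | succ v ih =>
    rw [Nat.factorial_succ]
    push_cast
    have h1 : (0 : ℝ) < v + 1 := by positivity
    have h2 : (0 : ℝ) < v + 2 := by positivity
    rw [Real.log_mul h1.ne' (by positivity)]
    have h3 : 1 / (v + 2 : ℝ) ≤ Real.log (v + 1 + 1) - Real.log (v + 1) := by
      rw [← Real.log_div (by positivity) h1.ne']
      have := Real.one_sub_inv_le_log_of_pos (x := ((v : ℝ) + 1 + 1) / (v + 1)) (by positivity)
      refine le_trans (le_of_eq ?_) this
      field_simp
      ring
    have h4 : 1 - 1 / (v + 1 : ℝ) ≤ v * (Real.log (v + 1) - Real.log v) := by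
      rcases Nat.eq_zero_or_pos v with rfl | hv
      · simp
      have hv0 : (0 : ℝ) < v := by exact_mod_cast hv
      rw [← Real.log_div h1.ne' hv0.ne']
      have := Real.one_sub_inv_le_log_of_pos (x := ((v : ℝ) + 1) / v) (by positivity)
      have h5 := mul_le_mul_of_nonneg_left this hv0.le
      refine le_trans (le_of_eq ?_) h5
      field_simp
      ring
    have h6 : 1 / (v + 1 : ℝ) ≤ 2 * (1 / (v + 2 : ℝ)) := by
      rw [mul_one_div, div_le_div_iff₀ h1 h2]
      have : (0 : ℝ) ≤ v := Nat.cast_nonneg v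
      linarith
    linarith

/-- A multinomial coefficient with entries slightly below those of the type `n ψ` is at least the
exponential of the entropy, up to a polynomial factor. -/
theorem log_factorial_sub_ge {A : Type*} [Fintype A] {v : A → ℕ} {ψ : A → ℝ} {n : ℝ} (hn : 0 < n)
    (hψ : ∀ j, 0 < ψ j) (hv : ∀ j, v j ≤ n * ψ j) (hvn : (∑ j, v j : ℕ) ≤ n) :
    -∑ j, v j * Real.log (ψ j) - (n - (∑ j, v j : ℕ)) -
        Fintype.card A * (2 * Real.log (n + 1) + 1) ≤
      Real.log (∑ j, v j).factorial - ∑ j, Real.log (v j).factorial := by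
  set N := ∑ j, v j with hN
  have h1 : ∀ j, Real.log (v j).factorial ≤
      v j * Real.log n + v j * Real.log (ψ j) - v j + (2 * Real.log (n + 1) + 1) := by
    intro j
    have h2 := log_factorial_le (v j)
    have h3 : Real.log ((v j : ℝ) + 1) ≤ Real.log (n + 1) := by
      refine Real.log_le_log (by positivity) ?_
      have : v j ≤ N := Finset.single_le_sum (fun _ _ => Nat.zero_le _) (Finset.mem_univ j)
      have : (v j : ℝ) ≤ N := by exact_mod_cast this
      linarith
    have h4 : v j * Real.log (v j) ≤ v j * Real.log n + v j * Real.log (ψ j) := by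
      rcases Nat.eq_zero_or_pos (v j) with h | h
      · simp [h]
      · have h0 : (0 : ℝ) < v j := by exact_mod_cast h
        rw [← mul_add, ← Real.log_mul hn.ne' (hψ j).ne']
        exact mul_le_mul_of_nonneg_left (Real.log_le_log h0 (hv j)) h0.le
    linarith
  have h5 := Finset.sum_le_sum fun j (_ : j ∈ Finset.univ) => h1 j
  rw [Finset.sum_add_distrib, Finset.sum_sub_distrib, Finset.sum_add_distrib, ← Finset.sum_mul,
    Finset.sum_const, Finset.card_univ, nsmul_eq_mul, ← Nat.cast_sum, ← hN] at h5
  have h6 := mul_log_sub_le_log_factorial N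
  have h7 : N * Real.log n - N * Real.log N ≤ n - N := by
    rcases Nat.eq_zero_or_pos N with h | h
    · simp [h, hn.le]
    · have h0 : (0 : ℝ) < N := by exact_mod_cast h
      rw [← mul_sub, ← Real.log_div hn.ne' h0.ne']
      have := mul_le_mul_of_nonneg_left (Real.log_le_sub_one_of_pos (div_pos hn h0)) h0.le
      refine this.trans (le_of_eq ?_)
      field_simp
  linarith

/-! ### The optimal geometric distribution -/

/-- The first-order condition at the minimum says that the distribution proportional to `ρ ^ i` has
mean `(q - 1) / 3`. -/
theorem exists_theta_minimizer {q : ℕ} (hq : 2 ≤ q) : ∃ ρ : ℝ, 0 < ρ ∧ ρ < 1 ∧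
    theta q = thetaFun q ρ ∧
    ∑ i ∈ Finset.range q, (3 * (i : ℝ) - (q - 1 : ℕ)) * ρ ^ i = 0 := by
  obtain ⟨⟨ρ, hρ, hθ⟩, hmin⟩ := theta_isLeast q hq
  have hρ0 : 0 < ρ := hρ
  have hq1 : ((q - 1 : ℕ) : ℝ) = q - 1 := by
    rw [Nat.cast_sub (by omega)]
    simp
  set s : ℝ := ((q : ℝ) - 1) / 3 with hs
  have hd1 : HasDerivAt (fun x : ℝ => ∑ i ∈ Finset.range q, x ^ i)
      (∑ i ∈ Finset.range q, (i : ℝ) * ρ ^ (i - 1)) ρ :=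
    HasDerivAt.fun_sum fun i _ => hasDerivAt_pow i ρ
  have hd2 : HasDerivAt (fun x : ℝ => x ^ (-s)) (-s * ρ ^ (-s - 1)) ρ :=
    Real.hasDerivAt_rpow_const (Or.inl hρ0.ne')
  have hloc : IsLocalMin (fun x : ℝ => (∑ i ∈ Finset.range q, x ^ i) * x ^ (-s)) ρ := by
    filter_upwards [Ioi_mem_nhds hρ0] with x hx
    have := hmin ⟨x, hx, rfl⟩
    rw [← hθ] at this
    exact this
  have hz := hloc.hasDerivAt_eq_zero (hd1.mul hd2)
  have hpow : ρ ^ (-s - 1) = ρ ^ (-s) / ρ := Real.rpow_sub_one hρ0.ne' _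
  have hps : 0 < ρ ^ (-s) := Real.rpow_pos_of_pos hρ0 _
  have hderiv : ∑ i ∈ Finset.range q, (i : ℝ) * ρ ^ (i - 1) =
      (∑ i ∈ Finset.range q, (i : ℝ) * ρ ^ i) / ρ := by
    rw [Finset.sum_div]
    refine Finset.sum_congr rfl fun i _ => ?_
    rcases i with _ | i
    · simp
    · rw [Nat.add_sub_cancel, pow_succ]
      field_simp
  have hmean : ∑ i ∈ Finset.range q, (3 * (i : ℝ) - (q - 1 : ℕ)) * ρ ^ i = 0 := by
    have h1 : ∑ i ∈ Finset.range q, (i : ℝ) * ρ ^ i = s * ∑ i ∈ Finset.range q, ρ ^ i := by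
      rw [hderiv, hpow] at hz
      field_simp at hz
      have := (mul_eq_zero.1 (hz.trans (mul_zero _))).resolve_left hps.ne'
      linarith
    simp only [sub_mul, Finset.sum_sub_distrib, mul_assoc, ← Finset.mul_sum]
    rw [h1, hq1, hs]
    ring
  refine ⟨ρ, hρ0, ?_, hθ.symm, hmean⟩
  -- for `ρ ≥ 1`, Chebyshev's inequality bounds the mean from below by that of the uniform
  -- distribution, which is too large
  by_contra! hρ1
  have hmono : MonovaryOn (fun i : ℕ => 3 * (i : ℝ) - (q - 1 : ℕ)) (fun i : ℕ => ρ ^ i)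
      (Finset.range q : Set ℕ) := by
    refine Monovary.monovaryOn (Monotone.monovary (fun i j hij => ?_)
      (pow_right_mono₀ hρ1)) _
    have : (i : ℝ) ≤ j := by exact_mod_cast hij
    linarith
  have hch := hmono.sum_mul_sum_le_card_mul_sum
  rw [hmean, mul_zero] at hch
  have hS : 0 < ∑ i ∈ Finset.range q, ρ ^ i :=
    Finset.sum_pos (fun i _ => by positivity) ⟨0, Finset.mem_range.2 (by omega)⟩
  have hlin : 0 < ∑ i ∈ Finset.range q, (3 * (i : ℝ) - (q - 1 : ℕ)) := by
    have h2 : ∀ n : ℕ, ∑ i ∈ Finset.range n, (3 * (i : ℝ) - (q - 1 : ℕ)) =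
        n * (3 * (n - 1) / 2 - (q - 1 : ℕ)) := by
      intro n
      induction n with
      | zero => simp
      | succ n ih =>
        rw [Finset.sum_range_succ, ih]
        push_cast
        ring
    rw [h2, hq1]
    have : (2 : ℝ) ≤ q := by exact_mod_cast hq
    nlinarith
  exact absurd hch (not_le.2 (mul_pos hlin hS))

theorem one_le_theta {q : ℕ} (hq : 2 ≤ q) : 1 ≤ theta q := by
  obtain ⟨ρ, hρ0, hρ1, hθ, -⟩ := exists_theta_minimizer hq
  have h2 : (2 : ℝ) ≤ q := by exact_mod_cast hq
  rw [hθ, thetaFun]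
  have h1 : (1 : ℝ) ≤ ∑ i ∈ Finset.range q, ρ ^ i := by
    have := Finset.single_le_sum (f := fun i => ρ ^ i) (s := Finset.range q)
      (fun i _ => by positivity) (Finset.mem_range.2 (show 0 < q by omega))
    simpa using this
  exact one_le_mul_of_one_le_of_one_le h1
    (Real.one_le_rpow_of_pos_of_le_one_of_nonpos hρ0 hρ1.le (by linarith))

theorem log_theta_eq {q : ℕ} (hq : 2 ≤ q) {ρ : ℝ} (hρ : 0 < ρ) (hθ : theta q = thetaFun q ρ) :
    Real.log (theta q) =
      Real.log (∑ i ∈ Finset.range q, ρ ^ i) - ((q : ℝ) - 1) / 3 * Real.log ρ := by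
  have hS : 0 < ∑ i ∈ Finset.range q, ρ ^ i :=
    Finset.sum_pos (fun i _ => by positivity) ⟨0, Finset.mem_range.2 (by omega)⟩
  rw [hθ, thetaFun, Real.log_mul hS.ne' (Real.rpow_pos_of_pos hρ _).ne', Real.log_rpow hρ]
  ring

/-! ### Integral types close to the optimal distribution -/

theorem sum_sumTriples_rotate {s : ℕ} (f : ℕ × ℕ × ℕ → ℝ) :
    ∑ t ∈ sumTriples s, f (t.2.1, t.2.2, t.1) = ∑ t ∈ sumTriples s, f t := by
  refine Finset.sum_nbij' (fun t => (t.2.1, t.2.2, t.1)) (fun t => (t.2.2, t.1, t.2.1))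
    ?_ ?_ ?_ ?_ ?_
  · intro t ht
    rw [mem_sumTriples] at ht ⊢
    dsimp only
    omega
  · intro t ht
    rw [mem_sumTriples] at ht ⊢
    dsimp only
    omega
  · intro t _
    rfl
  · intro t _
    rfl
  · intro t _
    rfl

/-- A marginal supported on `[0, q - 1]` is the first marginal of a weight on triples of letters
that is invariant under rotation. -/
theorem IsTripleMarginal.exists_rotation_invariant {q : ℕ} (hq : 2 ≤ q) {ψ : ℕ → ℝ}
    (h : IsTripleMarginal (q - 1) ψ) : ∃ π : Fin q × Fin q × Fin q → ℝ, (∀ t, 0 ≤ π t) ∧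
      (∀ t, π (t.2.1, t.2.2, t.1) = π t) ∧
      (∀ t, π t ≠ 0 → (t.1 : ℕ) + t.2.1 + t.2.2 = q - 1) ∧
      ∀ j, ∑ b, ∑ c, π (j, b, c) = ψ j := by
  obtain ⟨w, hw0, hw⟩ := h
  set g : ℕ × ℕ × ℕ → ℝ := fun t => w t + w (t.2.1, t.2.2, t.1) + w (t.2.2, t.1, t.2.1) with hg
  refine ⟨fun t => if (t.1 : ℕ) + t.2.1 + t.2.2 = q - 1 then g (t.1, t.2.1, t.2.2) else 0,
    fun t => ?_, fun t => ?_, fun t ht => ?_, fun j => ?_⟩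
  · dsimp only
    split_ifs
    · exact add_nonneg (add_nonneg (hw0 _) (hw0 _)) (hw0 _)
    · exact le_rfl
  · refine if_congr (by dsimp only; omega) ?_ rfl
    simp only [hg]
    ring
  · by_contra hne
    exact ht (if_neg hne)
  · have h1 : ∑ t ∈ sumTriples (q - 1), g t * (if t.1 = (j : ℕ) then 1 else 0) = ψ j := by
      rw [← hw]
      simp only [hg, coordCount, add_mul, mul_add, Finset.sum_add_distrib]
      have e1 := sum_sumTriples_rotate (s := q - 1)
        (fun t => w t * (if t.2.2 = (j : ℕ) then 1 else 0))
      have e2 := sum_sumTriples_rotate (s := q - 1)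
        (fun t => w (t.2.1, t.2.2, t.1) * (if t.2.2 = (j : ℕ) then 1 else 0))
      have e3 := sum_sumTriples_rotate (s := q - 1)
        (fun t => w t * (if t.2.1 = (j : ℕ) then 1 else 0))
      dsimp only at e1 e2 e3
      linarith
    rw [← h1, sumTriples, Finset.sum_filter, show q - 1 + 1 = q by omega, Finset.sum_product,
      Finset.sum_range]
    symm
    rw [Finset.sum_eq_single j]
    · rw [Finset.sum_product, Finset.sum_range]
      refine Finset.sum_congr rfl fun b _ => ?_
      rw [Finset.sum_range]
      refine Finset.sum_congr rfl fun c _ => ?_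
      simp
    · intro a _ ha
      refine Finset.sum_eq_zero fun p _ => ?_
      have : ¬ (a : ℕ) = j := fun hh => ha (Fin.ext hh)
      simp [this]
    · intro hj
      exact absurd (Finset.mem_univ j) hj

/-- The optimal distribution, coupled and rounded down: the multiplicities `k` have total between
`n - q ^ 3` and `n`, and a first marginal of at most `n ψ`. -/
theorem exists_rotation_invariant_counts {q : ℕ} (hq : 2 ≤ q) {ρ : ℝ} (hρ0 : 0 < ρ) (hρ1 : ρ < 1)
    (hmean : ∑ i ∈ Finset.range q, (3 * (i : ℝ) - (q - 1 : ℕ)) * ρ ^ i = 0) (n : ℕ) :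
    ∃ k : Fin q × Fin q × Fin q → ℕ, (∀ t, k (t.2.1, t.2.2, t.1) = k t) ∧
      (∀ t, k t ≠ 0 → (t.1 : ℕ) + t.2.1 + t.2.2 = q - 1) ∧
      ∑ t, k t ≤ n ∧ n ≤ ∑ t, k t + q ^ 3 ∧
      ∀ j : Fin q, ((∑ b, ∑ c, k (j, b, c) : ℕ) : ℝ) ≤
        n * (ρ ^ (j : ℕ) / ∑ i ∈ Finset.range q, ρ ^ i) := by
  set S := ∑ i ∈ Finset.range q, ρ ^ i with hS
  have hS0 : 0 < S :=
    Finset.sum_pos (fun i _ => by positivity) ⟨0, Finset.mem_range.2 (by omega)⟩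
  have hM : IsTripleMarginal (q - 1) fun i => if i < q then ρ ^ i / S else 0 := by
    refine isTripleMarginal_of_antitone (q - 1) (antitone_nat_of_succ_le fun i => ?_)
      (fun i hi => if_neg (by omega)) ?_
    · split_ifs with h1 h2
      · exact div_le_div_of_nonneg_right
          (pow_le_pow_of_le_one hρ0.le hρ1.le (Nat.le_succ i)) hS0.le
      · omega
      · positivity
      · exact le_rfl
    · rw [show q - 1 + 1 = q by omega]
      have h1 := congrArg (· / S) hmean
      rw [Finset.sum_div, zero_div] at h1
      rw [← h1]
      refine Finset.sum_congr rfl fun i hi => ?_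
      rw [if_pos (Finset.mem_range.1 hi), mul_div_assoc]
  obtain ⟨π, hπ0, hrot, hsupp, hmarg⟩ := hM.exists_rotation_invariant hq
  have htot : ∑ t, π t = 1 := by
    rw [Fintype.sum_prod_type]
    simp only [Fintype.sum_prod_type, hmarg, Fin.is_lt, if_true]
    rw [← Finset.sum_div, Fin.sum_univ_eq_sum_range, ← hS, div_self hS0.ne']
  have hfl : ∀ t, (⌊n * π t⌋₊ : ℝ) ≤ n * π t := fun t =>
    Nat.floor_le (mul_nonneg (Nat.cast_nonneg n) (hπ0 t))
  refine ⟨fun t => ⌊n * π t⌋₊, fun t => by dsimp only; rw [hrot], fun t ht => hsupp t fun h => ht ?_, ?_, ?_,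
    fun j => ?_⟩
  · simp [h]
  · have : ((∑ t, ⌊n * π t⌋₊ : ℕ) : ℝ) ≤ n := by
      push_cast
      refine (Finset.sum_le_sum fun t _ => hfl t).trans ?_
      rw [← Finset.mul_sum, htot, mul_one]
    exact_mod_cast this
  · have : (n : ℝ) ≤ ((∑ t, ⌊n * π t⌋₊ : ℕ) : ℝ) + q ^ 3 := by
      push_cast
      have h1 : ∑ t, (n * π t - 1) ≤ ∑ t, (⌊n * π t⌋₊ : ℝ) :=
        Finset.sum_le_sum fun t _ => by linarith [Nat.lt_floor_add_one (n * π t)]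
      rw [Finset.sum_sub_distrib, ← Finset.mul_sum, htot, Finset.sum_const, Finset.card_univ,
        Fintype.card_prod, Fintype.card_prod, Fintype.card_fin, nsmul_eq_mul] at h1
      push_cast at h1
      linarith
    exact_mod_cast this
  · push_cast
    refine (Finset.sum_le_sum fun b _ => Finset.sum_le_sum fun c _ => hfl _).trans ?_
    simp only [← Finset.mul_sum]
    rw [hmarg, if_pos j.2]

/-- For every length `n` there is a word of length at most `n` with mean letter `(q - 1) / 3` that
occurs in a triple of rearrangements with sum `q - 1`, and has `θ ^ n` rearrangements up to a
polynomial factor. -/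
theorem exists_word {q : ℕ} (hq : 2 ≤ q) : ∃ C : ℝ, ∀ n : ℕ, 1 ≤ n →
    ∃ (ι : Type) (_ : Fintype ι) (_ : DecidableEq ι) (w : ι → Fin q), Fintype.card ι ≤ n ∧
      3 * ∑ i, (w i : ℕ) = Fintype.card ι * (q - 1) ∧ 0 < tripleDegree w w ∧
      Real.log (rearrangements w).card ≤ n * Real.log (theta q) ∧
      n * Real.log (theta q) - C - 2 * q * Real.log (n + 1) ≤
        Real.log (rearrangements w).card := by
  obtain ⟨ρ, hρ0, hρ1, hθ, hmean⟩ := exists_theta_minimizer hq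
  set S := ∑ i ∈ Finset.range q, ρ ^ i with hS
  have hS0 : 0 < S :=
    Finset.sum_pos (fun i _ => by positivity) ⟨0, Finset.mem_range.2 (by omega)⟩
  have hlogθ : 0 ≤ Real.log (theta q) := Real.log_nonneg (one_le_theta hq)
  have hlog := log_theta_eq hq hρ0 hθ
  rw [← hS] at hlog
  have hq1 : ((q - 1 : ℕ) : ℝ) = q - 1 := by
    rw [Nat.cast_sub (by omega)]
    simp
  refine ⟨q ^ 3 * Real.log (theta q) + q ^ 3 + q, fun n hn => ?_⟩
  obtain ⟨k, hrot, hsupp, hle, hge, hk⟩ :=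
    exists_rotation_invariant_counts hq hρ0 hρ1 hmean n
  rw [← hS] at hk
  let w : (Σ t, Fin (k t)) → Fin q := fun i => i.1.1
  -- the rotation of triples permutes the places
  let r : (Fin q × Fin q × Fin q) ≃ (Fin q × Fin q × Fin q) :=
    ⟨fun t => (t.2.1, t.2.2, t.1), fun t => (t.2.2, t.1, t.2.1), fun _ => rfl, fun _ => rfl⟩
  let σ : Equiv.Perm (Σ t, Fin (k t)) :=
    Equiv.sigmaCongr r fun t => finCongr (hrot t).symm
  have hcard : Fintype.card (Σ t, Fin (k t)) = ∑ t, k t := by simp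
  have hsum : ∀ i, (w i : ℕ) + w (σ i) + w (σ (σ i)) = q - 1 := by
    rintro ⟨t, x⟩
    exact hsupp t (by have := x.2; omega)
  have hw : 3 * ∑ i, (w i : ℕ) = Fintype.card (Σ t, Fin (k t)) * (q - 1) := by
    have h1 := Finset.sum_congr (rfl : (Finset.univ : Finset (Σ t, Fin (k t))) = _)
      fun i _ => hsum i
    rw [Finset.sum_add_distrib, Finset.sum_add_distrib, Equiv.sum_comp σ (fun i => (w i : ℕ)),
      Equiv.sum_comp σ (fun i => (w (σ i) : ℕ)), Equiv.sum_comp σ (fun i => (w i : ℕ)),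
      Finset.sum_const, Finset.card_univ, smul_eq_mul] at h1
    omega
  have hcount : ∀ j, Fintype.card {i // w i = j} = ∑ b, ∑ c, k (j, b, c) := by
    intro j
    rw [Fintype.card_subtype, Finset.card_filter, ← Finset.univ_sigma_univ, Finset.sum_sigma,
      Fintype.sum_prod_type, Finset.sum_eq_single j]
    · rw [Fintype.sum_prod_type]
      simp [w]
    · intro a _ ha
      simp [w, ha]
    · intro hj
      exact absurd (Finset.mem_univ j) hj
  have hfib : ∀ f : Fin q → ℝ, ∑ j, (Fintype.card {i // w i = j} : ℝ) * f j = ∑ i, f (w i) := by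
    intro f
    rw [← Finset.sum_fiberwise Finset.univ w]
    refine Finset.sum_congr rfl fun j _ => ?_
    rw [Fintype.card_subtype, ← nsmul_eq_mul, ← Finset.sum_const]
    exact Finset.sum_congr rfl fun i hi => by rw [(Finset.mem_filter.1 hi).2]
  have hN : ∑ j, Fintype.card {i // w i = j} = Fintype.card (Σ t, Fin (k t)) := by
    have := hfib fun _ => 1
    simp only [mul_one, Finset.sum_const, Finset.card_univ, nsmul_eq_mul] at this
    exact_mod_cast this
  set N := Fintype.card (Σ t, Fin (k t)) with hNdef
  have hwR : ∑ i, ((w i : ℕ) : ℝ) = N * ((q - 1) / 3) := by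
    have : (3 * ∑ i, ((w i : ℕ) : ℝ)) = N * (q - 1) := by
      rw [← hq1]
      exact_mod_cast hw
    linarith
  have hNn : (N : ℝ) ≤ n := by exact_mod_cast hcard ▸ hle
  have hNn' : (n : ℝ) ≤ N + q ^ 3 := by exact_mod_cast hcard ▸ hge
  have hV0 : 0 < ((rearrangements w).card : ℝ) := by
    exact_mod_cast Finset.card_pos.2 ⟨w, self_mem_rearrangements w⟩
  refine ⟨_, inferInstance, inferInstance, w, hcard.le.trans hle, hw, ?_, ?_, ?_⟩
  · refine Finset.card_pos.2 ⟨(w, w ∘ σ, (w ∘ σ) ∘ σ), Finset.mem_filter.2 ⟨?_, rfl⟩⟩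
    have h0 := self_mem_rearrangements w
    have h1 := comp_mem_rearrangements h0 σ
    exact mem_wordTriples.2 ⟨⟨h0, h1, comp_mem_rearrangements h1 σ⟩, hsum⟩
  · have h1 := card_rearrangements_mul_pow_le hρ0 w
    rw [← hS, ← hNdef] at h1
    have h2 := Real.log_le_log (by positivity) h1
    rw [Real.log_mul hV0.ne' (by positivity), Real.log_pow, Real.log_pow] at h2
    push_cast at h2
    rw [hwR] at h2
    have h3 : (N : ℝ) * Real.log (theta q) ≤ n * Real.log (theta q) := by gcongr
    rw [hlog] at h3 ⊢
    linarith
  · have h1 := log_factorial_sub_ge (v := fun j => Fintype.card {i // w i = j})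
      (ψ := fun j : Fin q => ρ ^ (j : ℕ) / S) (n := n) (by exact_mod_cast hn)
      (fun j => div_pos (pow_pos hρ0 _) hS0) (fun j => by rw [hcount]; exact hk j)
      (by rw [hN]; exact hNn)
    rw [hN, hfib] at h1
    have h2 : ∑ i, Real.log (ρ ^ (w i : ℕ) / S) = -(N * Real.log (theta q)) := by
      have h3 : ∀ i, Real.log (ρ ^ (w i : ℕ) / S) = (w i : ℕ) * Real.log ρ - Real.log S :=
        fun i => by rw [Real.log_div (by positivity) hS0.ne', Real.log_pow]
      simp only [h3]
      rw [Finset.sum_sub_distrib, ← Finset.sum_mul, hwR, Finset.sum_const, Finset.card_univ,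
        nsmul_eq_mul, hlog]
      ring
    have h4 := congrArg (fun m : ℕ => Real.log m) (card_rearrangements_mul w)
    push_cast at h4
    rw [Real.log_mul hV0.ne' (Finset.prod_ne_zero_iff.2 fun j _ => by positivity),
      Real.log_prod (fun j _ => by positivity)] at h4
    rw [h2, Fintype.card_fin] at h1
    have h5 : (n : ℝ) * Real.log (theta q) ≤ (N + q ^ 3) * Real.log (theta q) := by gcongr
    linarith

/-! ### Sum-free sets from words -/

/-- Reduction modulo an odd number `p` keeps subsets of `[0, (p - 1) / 2]` free of arithmetic
progressions of length three. -/
theorem exists_threeAPFree_zmod (p : ℕ) [NeZero p] (hp : p % 2 = 1) :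
    ∃ R : Finset (ZMod p), ThreeAPFree (R : Set (ZMod p)) ∧
      R.card = rothNumberNat ((p + 1) / 2) := by
  obtain ⟨T, hT, hcard, hfree⟩ := rothNumberNat_spec ((p + 1) / 2)
  have hlt : ∀ a ∈ T, 2 * a < p := fun a ha => by
    have := Finset.mem_range.1 (hT ha)
    omega
  have hinj : ∀ m m' : ℕ, m < p → m' < p → (m : ZMod p) = m' → m = m' := by
    intro m m' hm hm' h
    rw [ZMod.natCast_eq_natCast_iff'] at h
    rwa [Nat.mod_eq_of_lt hm, Nat.mod_eq_of_lt hm'] at h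
  refine ⟨T.image fun a : ℕ => (a : ZMod p), ?_, ?_⟩
  · intro a ha b hb c hc habc
    rw [Finset.mem_coe, Finset.mem_image] at ha hb hc
    obtain ⟨a, ha, rfl⟩ := ha
    obtain ⟨b, hb, rfl⟩ := hb
    obtain ⟨c, hc, rfl⟩ := hc
    have h1 := hlt a ha
    have h2 := hlt b hb
    have h3 := hlt c hc
    have h4 : a + c = b + b := hinj _ _ (by omega) (by omega) (by exact_mod_cast habc)
    rw [hfree ha hb hc h4]
  · rw [Finset.card_image_of_injOn, hcard]
    intro a ha b hb h
    have h1 := hlt a ha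
    have h2 := hlt b hb
    exact hinj a b (by omega) (by omega) h

/-- Triples of words that are isolated among all triples of rearrangements of `w` yield sum-free
sets, after padding and a translation that moves the target from `-1` to `t`. -/
theorem exists_isSumFreeWithTarget {q n : ℕ} (hq : 2 ≤ q) {ι : Type} [Fintype ι] [DecidableEq ι]
    {w : ι → Fin q} (hn : Fintype.card ι ≤ n)
    (hw : 3 * ∑ i, (w i : ℕ) = Fintype.card ι * (q - 1))
    {S : Finset ((ι → Fin q) × (ι → Fin q) × (ι → Fin q))} (hS : S ⊆ wordTriples w)
    (hiso : ∀ x ∈ S, ∀ y ∈ S, ∀ z ∈ S, (x.1, y.2.1, z.2.2) ∈ wordTriples w → x = y ∧ y = z)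
    (t : Fin n → ZMod q) :
    ∃ T : Finset ((Fin n → ZMod q) × (Fin n → ZMod q) × (Fin n → ZMod q)),
      IsSumFreeWithTarget t T ∧ T.card = S.card := by
  classical
  obtain ⟨e⟩ : Nonempty (ι ↪ Fin n) :=
    Function.Embedding.nonempty_of_card_le (by rwa [Fintype.card_fin])
  set pad : (ι → Fin q) → Fin n → ZMod q :=
    fun a => Function.extend e (fun i => ((a i : ℕ) : ZMod q)) 0 with hpad
  set τ : Fin n → ZMod q := t + Function.extend e 1 0 with hτ
  have hpad_apply : ∀ a i, pad a (e i) = ((a i : ℕ) : ZMod q) := fun a i =>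
    e.injective.extend_apply _ _ i
  have hinj : Function.Injective pad := by
    intro a b h
    funext i
    have h1 := congrFun h (e i)
    rw [hpad_apply, hpad_apply, ZMod.natCast_eq_natCast_iff', Nat.mod_eq_of_lt (a i).2,
      Nat.mod_eq_of_lt (b i).2] at h1
    exact Fin.ext h1
  have hsum : ∀ a b c, pad a + τ + pad b + pad c = t ↔ ∀ i, q ∣ (a i : ℕ) + b i + c i + 1 := by
    intro a b c
    constructor
    · intro h i
      have h1 := congrFun h (e i)
      simp only [Pi.add_apply, hpad_apply, hτ, e.injective.extend_apply, Pi.one_apply] at h1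
      rw [← ZMod.natCast_eq_zero_iff]
      push_cast
      linear_combination h1
    · intro h
      funext j
      by_cases hj : ∃ i, e i = j
      · obtain ⟨i, rfl⟩ := hj
        simp only [Pi.add_apply, hpad_apply, hτ, e.injective.extend_apply, Pi.one_apply]
        have h1 := (ZMod.natCast_eq_zero_iff _ q).2 (h i)
        push_cast at h1
        linear_combination h1
      · simp [hpad, hτ, Function.extend_apply' _ _ _ hj]
  have hfree : ∀ x ∈ S, ∀ y ∈ S, ∀ z ∈ S,
      pad x.1 + τ + pad y.2.1 + pad z.2.2 = t → x = y ∧ y = z := by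
    intro x hx y hy z hz h
    exact hiso x hx y hy z hz (mem_wordTriples_of_modEq hw (mem_wordTriples.1 (hS hx)).1.1
      (mem_wordTriples.1 (hS hy)).1.2.1 (mem_wordTriples.1 (hS hz)).1.2.2 ((hsum _ _ _).1 h))
  refine ⟨S.image fun x => (pad x.1 + τ, pad x.2.1, pad x.2.2), ?_, ?_⟩
  · intro x hx y hy z hz
    rw [Finset.mem_image] at hx hy hz
    obtain ⟨x, hx, rfl⟩ := hx
    obtain ⟨y, hy, rfl⟩ := hy
    obtain ⟨z, hz, rfl⟩ := hz
    constructor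
    · intro h
      obtain ⟨rfl, rfl⟩ := hfree x hx y hy z hz h
      exact ⟨rfl, rfl⟩
    · rintro ⟨h1, h2⟩
      rw [← h2, ← h1, hsum]
      intro i
      rw [(mem_wordTriples.1 (hS hx)).2 i, Nat.sub_add_cancel (by omega)]
  · refine Finset.card_image_of_injective _ fun x y h => ?_
    simp only [Prod.mk.injEq, add_left_inj] at h
    exact Prod.ext (hinj h.1) (Prod.ext (hinj h.2.1) (hinj h.2.2))

/-- Isolated triples of words, obtained by hashing modulo a prime `p`. -/
theorem exists_isolated_wordTriples {q p : ℕ} [Fact p.Prime] (hqp : q ≤ p) (hp2 : p % 2 = 1)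
    {ι : Type} [Fintype ι] [DecidableEq ι] {w : ι → Fin q} (hD : 6 * tripleDegree w w ≤ p) :
    ∃ S ⊆ wordTriples w,
      (rearrangements w).card * tripleDegree w w * rothNumberNat ((p + 1) / 2) ≤
        2 * p ^ 2 * S.card ∧
      ∀ x ∈ S, ∀ y ∈ S, ∀ z ∈ S, (x.1, y.2.1, z.2.2) ∈ wordTriples w → x = y ∧ y = z := by
  classical
  obtain ⟨R, hR, hRcard⟩ := exists_threeAPFree_zmod p hp2
  set φ : (ι → Fin q) → ι → ZMod p := fun a i => ((a i : ℕ) : ZMod p) with hφ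
  have hφinj : Function.Injective φ := by
    intro a b h
    funext i
    have h1 := congrFun h i
    simp only [hφ] at h1
    rw [ZMod.natCast_eq_natCast_iff', Nat.mod_eq_of_lt ((a i).2.trans_le hqp),
      Nat.mod_eq_of_lt ((b i).2.trans_le hqp)] at h1
    exact Fin.ext h1
  set Φ : (ι → Fin q) × (ι → Fin q) × (ι → Fin q) →
      (ι → ZMod p) × (ι → ZMod p) × (ι → ZMod p) := fun x => (φ x.1, φ x.2.1, φ x.2.2) with hΦ
  have hΦinj : Function.Injective Φ := by
    intro x y h
    simp only [hΦ, Prod.mk.injEq] at h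
    exact Prod.ext (hφinj h.1) (Prod.ext (hφinj h.2.1) (hφinj h.2.2))
  have h2 : (2 : ZMod p) ≠ 0 := by
    intro h
    have h3 : ((2 : ℕ) : ZMod p) = 0 := by exact_mod_cast h
    rw [ZMod.natCast_eq_zero_iff] at h3
    have h4 := (Fact.out : p.Prime).two_le
    have h5 := Nat.le_of_dvd two_pos h3
    omega
  have hdeg : ∀ (f : ∀ {A : Type}, A × A × A → A),
      (∀ x, f (Φ x) = φ (f x)) →
      (∀ x ∈ wordTriples w, ((wordTriples w).filter fun y => f x = f y).card ≤
        tripleDegree w w) →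
      ∀ x ∈ (wordTriples w).image Φ, (((wordTriples w).image Φ).filter fun y => f x = f y).card ≤
        tripleDegree w w := by
    intro f hf h x hx
    obtain ⟨x, hx', rfl⟩ := Finset.mem_image.1 hx
    rw [Finset.filter_image]
    refine Finset.card_image_le.trans ?_
    refine le_trans (Finset.card_le_card fun y hy => ?_) (h x hx')
    rw [Finset.mem_filter] at hy ⊢
    rw [hf, hf] at hy
    exact ⟨hy.1, hφinj hy.2⟩
  obtain ⟨S, hSX, hScard, hSiso⟩ := exists_isolated_subset (F := ZMod p)
    (u := fun _ => ((q - 1 : ℕ) : ZMod p)) (X := (wordTriples w).image Φ) (R := R)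
    (D := tripleDegree w w) h2 (by
      intro x hx
      obtain ⟨x, hx', rfl⟩ := Finset.mem_image.1 hx
      funext i
      simp only [hΦ, hφ, Pi.add_apply]
      exact_mod_cast congrArg (Nat.cast : ℕ → ZMod p) ((mem_wordTriples.1 hx').2 i)) hR
    (hdeg (fun x => x.1) (fun _ => rfl) fun x hx =>
      (tripleDegree_eq (mem_wordTriples.1 hx).1.1).le)
    (hdeg (fun x => x.2.1) (fun _ => rfl) fun x hx =>
      card_filter_snd_le (mem_wordTriples.1 hx).1.2.1)
    (hdeg (fun x => x.2.2) (fun _ => rfl) fun x hx =>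
      card_filter_thd_le (mem_wordTriples.1 hx).1.2.2)
    (by rwa [ZMod.card])
  have hmem : ∀ x, x ∈ (wordTriples w).filter (fun x => Φ x ∈ S) ↔ Φ x ∈ S := by
    intro x
    rw [Finset.mem_filter]
    refine ⟨fun h => h.2, fun h => ⟨?_, h⟩⟩
    obtain ⟨y, hy, hyx⟩ := Finset.mem_image.1 (hSX h)
    rwa [← hΦinj hyx]
  refine ⟨(wordTriples w).filter fun x => Φ x ∈ S, Finset.filter_subset _ _, ?_, ?_⟩
  · rw [Finset.card_image_of_injective _ hΦinj, card_wordTriples, hRcard, ZMod.card] at hScard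
    refine hScard.trans (Nat.mul_le_mul_left _ ?_)
    have : S ⊆ ((wordTriples w).filter fun x => Φ x ∈ S).image Φ := by
      intro y hy
      obtain ⟨x, hx, rfl⟩ := Finset.mem_image.1 (hSX hy)
      exact Finset.mem_image_of_mem _ ((hmem x).2 hy)
    exact (Finset.card_le_card this).trans Finset.card_image_le
  · intro x hx y hy z hz h
    rw [hmem] at hx hy hz
    obtain ⟨h1, h2⟩ := hSiso _ hx _ hy _ hz (Finset.mem_image_of_mem Φ h)
    exact ⟨hΦinj h1, hΦinj h2⟩

theorem theorem2 (q : ℕ) (hq : 2 ≤ q) :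
    ∃ (C : ℝ) (N : ℕ), ∀ n : ℕ, N ≤ n → ∀ t : Fin n → ZMod q,
      ∃ S : Finset ((Fin n → ZMod q) × (Fin n → ZMod q) × (Fin n → ZMod q)),
        IsSumFreeWithTarget t S ∧
        (theta q) ^ n *
            Real.exp (-(2 * Real.sqrt (2 * Real.log 2 * Real.log (theta q) * (n : ℝ)))
              - C * Real.log (n : ℝ))
          ≤ (S.card : ℝ) := by
  obtain ⟨C₁, hword⟩ := exists_word hq
  obtain ⟨A, hA, hroth⟩ := exists_rothNumberNat_ge
  have hl2 : 0 < Real.log 2 := Real.log_pos one_lt_two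
  have hq0 : (0 : ℝ) < q := by positivity
  set l := Real.log (theta q) with hl
  have hl0 : 0 ≤ l := Real.log_nonneg (one_le_theta hq)
  have hθ0 : 0 < theta q := lt_of_lt_of_le one_pos (one_le_theta hq)
  set c₀ := Real.log (12 * q) with hc₀
  have hc₀0 : 0 ≤ c₀ := Real.log_nonneg (by
    have : (2 : ℝ) ≤ q := by exact_mod_cast hq
    linarith)
  set B := 48 * q * A * (1 + c₀ + l) with hB
  have hB0 : 0 < B := by positivity
  set K := |C₁ + 2 * Real.sqrt (2 * Real.log 2 * c₀) + Real.log B| with hK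
  refine ⟨K / Real.log 2 + 4 * q + 1, 2, fun n hn t => ?_⟩
  have hn2 : (2 : ℝ) ≤ n := by exact_mod_cast hn
  have hn0 : (0 : ℝ) < n := by linarith
  obtain ⟨ι, _, _, w, hιn, hw, hD, hVle, hVge⟩ := hword n (by omega)
  set V := (rearrangements w).card with hV
  set D := tripleDegree w w with hDdef
  have hDV : D ≤ V := tripleDegree_le_card w
  -- the factor `6` makes collisions rare, and the factor `q` separates the letters modulo `p`
  obtain ⟨p, hp, hplt, hple⟩ := Nat.exists_prime_lt_and_le_two_mul (6 * q * D) (by positivity)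
  have : Fact p.Prime := ⟨hp⟩
  have h6 : 6 * D ≤ 6 * q * D := Nat.mul_le_mul_right _ (by omega)
  have hqp : q ≤ p := by nlinarith
  have hp2 : p % 2 = 1 := (hp.eq_two_or_odd).resolve_left (by omega)
  obtain ⟨S, hSW, hScard, hiso⟩ := exists_isolated_wordTriples hqp hp2 (w := w) (by omega)
  rw [← hV, ← hDdef] at hScard
  obtain ⟨T, hT, hTcard⟩ := exists_isSumFreeWithTarget hq hιn hw hSW hiso t
  refine ⟨T, hT, ?_⟩
  rw [hTcard]
  set M := (p + 1) / 2 with hM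
  have hp0 : (0 : ℝ) < p := by exact_mod_cast hp.pos
  have hM1 : 1 ≤ M := by
    have := hp.two_le
    omega
  have hMp : (p : ℝ) / 2 ≤ M := by
    have : p ≤ 2 * M := by omega
    have : (p : ℝ) ≤ 2 * M := by exact_mod_cast this
    linarith
  have hMp' : (M : ℝ) ≤ p := by
    have := hp.two_le
    exact_mod_cast (show M ≤ p by omega)
  have hM0 : (0 : ℝ) < M := by exact_mod_cast hM1
  have hV0 : (0 : ℝ) < V := by exact_mod_cast hD.trans_le hDV
  have hD0 : (0 : ℝ) < D := by exact_mod_cast hD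
  have hlogM : Real.log M ≤ c₀ + n * l := by
    have h1 : (M : ℝ) ≤ 12 * q * V := by
      have h2 : (p : ℝ) ≤ 2 * (6 * q * D) := by exact_mod_cast hple
      have h3 : (D : ℝ) ≤ V := by exact_mod_cast hDV
      have h4 : (12 * q : ℝ) * D ≤ 12 * q * V := by gcongr
      linarith
    have h2 := Real.log_le_log hM0 h1
    rw [Real.log_mul (by positivity) hV0.ne'] at h2
    linarith
  have hlogM0 : 0 ≤ Real.log M := Real.log_natCast_nonneg M
  set E := Real.exp (-(2 * Real.sqrt (2 * Real.log 2 * Real.log M))) with hE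
  -- the size of the set of isolated triples
  have hcard : V * E / (B * n) ≤ (S.card : ℝ) := by
    have h1 : (V : ℝ) * D * rothNumberNat M ≤ 2 * p ^ 2 * S.card := by exact_mod_cast hScard
    have h2 := hroth M hM1
    have h3 : (p : ℝ) ≤ 12 * q * D := by
      have : (p : ℝ) ≤ 2 * (6 * q * D) := by exact_mod_cast hple
      linarith
    have h4 : 1 + Real.log M ≤ (1 + c₀ + l) * n := by nlinarith
    have h5 : p / 2 * E / (A * ((1 + c₀ + l) * n)) ≤ rothNumberNat M := by
      refine le_trans ?_ h2
      gcongr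
    have h6 : V * (p / (12 * q)) * (p / 2 * E / (A * ((1 + c₀ + l) * n))) ≤
        2 * p ^ 2 * S.card := by
      refine le_trans ?_ h1
      gcongr
      rw [div_le_iff₀ (by positivity)]
      linarith
    have h7 : V * (p / (12 * q)) * (p / 2 * E / (A * ((1 + c₀ + l) * n))) =
        2 * p ^ 2 * (V * E / (B * n)) := by
      rw [hB]
      field_simp
      ring
    rw [h7] at h6
    exact le_of_mul_le_mul_left h6 (by positivity)
  refine le_trans ?_ hcard
  rw [← Real.log_le_log_iff (by positivity) (by positivity), Real.log_mul (by positivity)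
    (Real.exp_pos _).ne', Real.log_exp, Real.log_pow, Real.log_div (by positivity) (by positivity),
    Real.log_mul hV0.ne' (Real.exp_pos _).ne', Real.log_exp, Real.log_mul hB0.ne' hn0.ne', ← hl]
  have hsqrt : Real.sqrt (2 * Real.log 2 * Real.log M) ≤
      Real.sqrt (2 * Real.log 2 * l * n) + Real.sqrt (2 * Real.log 2 * c₀) := by
    refine Real.sqrt_le_iff.2 ⟨by positivity, ?_⟩
    rw [add_sq, Real.sq_sqrt (by positivity), Real.sq_sqrt (by positivity)]
    have h1 := mul_le_mul_of_nonneg_left hlogM (show 0 ≤ 2 * Real.log 2 by positivity)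
    have h2 : 0 ≤ 2 * Real.sqrt (2 * Real.log 2 * l * n) * Real.sqrt (2 * Real.log 2 * c₀) := by
      positivity
    linarith
  have hlogn1 : Real.log (n + 1) ≤ 2 * Real.log n := by
    rw [← Nat.cast_ofNat, ← Real.log_pow]
    refine Real.log_le_log (by positivity) ?_
    nlinarith
  have hlogn : K ≤ K / Real.log 2 * Real.log n := by
    rw [div_mul_eq_mul_div, le_div_iff₀ hl2]
    exact mul_le_mul_of_nonneg_left (Real.log_le_log two_pos hn2) (abs_nonneg _)
  have hKle := le_abs_self (C₁ + 2 * Real.sqrt (2 * Real.log 2 * c₀) + Real.log B)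
  have h8 : 2 * q * Real.log (n + 1) ≤ 2 * q * (2 * Real.log n) := by gcongr
  linarith
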